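/- **Setting.** Let $M=(\mathcal S,\mathcal A,P,R,s_1,H,\psi)$ be a finite-horizon layered regularized MDP: $\mathcal S,\mathcal A$ are finite, $\mathcal S=\mathcal S_1\sqcup\dots\sqcup\mathcal S_H$ with $\mathcal S_1=\{s_1\}$, $P(\cdot\mid s,a)$ is a distribution on $\mathcal S_{h+1}$ for $s\in\mathcal S_h$, $h<H$ (the episode ends after layer $H$, and values of the state after layer $H$ are $0$), $R:\mathcal S\times\mathcal A\to[0,1]$, and $\psi(p;s)=\alpha\,\mathrm{KL}(p,\pi_{\rm ref}(\cdot|s))$ for $p\in\Delta(\mathcal A)$, with $\alpha>0$ and a reference policy $\pi_{\rm ref}$ of full support. For a policy $\pi:\mathcal S\to\Delta(\mathcal A)$ and $s\in\mathcal S_h$ let $$V^\pi(s)=\mathbb E^\pi\Big[\sum_{h'=h}^H\big(R(s_{h'},a_{h'})-\psi(\pi(\cdot|s_{h'});s_{h'})\big)\,\Big|\,s_h=s\Big],\qquad Q^\pi(s,a)=R(s,a)+\mathbb E_{s'\sim P(\cdot|s,a)}[V^\pi(s')],$$ $J(\pi)=V^\pi(s_1)$, $Q^\star(s,a)=\max_\pi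 Q^\pi(s,a)$, let $\pi^\star\in\arg\max_\pi J(\pi)$ be any optimal policy, let $d^\pi(s)$ be the probability that $\pi$ visits $s$, and $d^\pi(s,a)=d^\pi(s)\pi(a|s)$. For $f:\mathcal S\times\mathcal A\to\mathbb R$ put $f(s)=\max_{p\in\Delta(\mathcal A)}\{\mathbb E_{a\sim p}[f(s,a)]-\psi(p;s)\}$, let $\pi_f(\cdot|s)$ be the maximizer, and put $(\mathcal Tf)(s,a)=R(s,a)+\mathbb E_{s'\sim P(\cdot|s,a)}[f(s')]$. **Data.** Let $\mu\in\Delta(\mathcal S\times\mathcal A)$, $\mu(s)=\sum_a\mu(s,a)$, and let $\mathcal D$ consist of $n\ge1$ i.i.d. tuples $(s,a,r,s')$ with $(s,a)\sim\mu$, $r\in[0,1]$ almost surely, $\mathbb E[r|s,a]=R(s,a)$, and $s'\sim P(\cdot|s,a)$; $\mathbb E_{\mathcal D}$ is the empirical average. Assume that $\mu$ is admissible: $\sum_{(s,a)\in\mathcal S_h\times\mathcal A}\mu(s,a)P(s'|s,a)=\mu(s')$ for all $1\le h<H$ and $s'\in\mathcal S_{h+1}$. Let $C^{\pi^\star}=\max_{s,a}\frac{d^{\pi^\star}(s,a)}{H\mu(s,a)}$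 (with $0/0=0$), and assume $C^{\pi^\star}<\infty$ (otherwise the bound below is void). **Function classes.** Let $\mathcal F,\mathcal G$ be finite sets of functions $\mathcal S\times\mathcal A\to\mathbb R$ such that every $f\in\mathcal F$ takes values in $[0,H]$, $Q^\star\in\mathcal F$ ($Q^\star$-realizability), and $\mathcal Tf\in\mathcal G$ for all $f\in\mathcal F$ (Bellman completeness). **Algorithm (CQL).** For $\lambda>0$, let $$\hat f\in\arg\min_{f\in\mathcal F}\ \mathbb E_{(s,a)\sim\mathcal D}\big[f(s)-f(s,a)\big]+\lambda\,\mathbb E_{(s,a)\sim\mathcal D}\Big[\big(f(s,a)-[\hat{\mathcal T}f](s,a)\big)^2\Big],\qquad \hat{\mathcal T}f\in\arg\min_{g\in\mathcal G}\mathbb E_{(s,a,r,s')\sim\mathcal D}\big[(g(s,a)-r-f(s'))^2\big],$$ with arbitrary tie-breaking. **Theorem.** For every $K$ there is a constant $c>0$ that depends only on $K$ such that in the above setting, if $\alpha\le KH$, then for every $\delta\in(0,1)$ and $\lambda>0$, with probability at least $1-\delta$, $$J(\pi^\star)-J(\pi_{\hat f})\ \le\ c\,\frac{H^4}{\alpha^2}\left(\frac{\lambda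 H^2\log(|\mathcal F||\mathcal G|/\delta)}{n}+\frac{H\,C^{\pi^\star}}{\lambda}\right)$$ (for every way of breaking the ties in $\hat{\mathcal T}f$ and $\hat f$). -/

import Mathlib

open MeasureTheory ProbabilityTheory

noncomputable section

/-- A policy: an action distribution at every state. -/
abbrev Policy (S A : Type*) [Fintype A] := S → stdSimplex ℝ A

/-- The Kullback-Leibler divergence `∑ a, p a * log (p a / q a)` of distributions on a finite set
(it is only used with `q` of full support; the terms with `p a = 0` vanish). -/
def klFin {A : Type*} [Fintype A] (p q : stdSimplex ℝ A) : ℝ :=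
  ∑ a, p.1 a * Real.log (p.1 a / q.1 a)

/-- A finite-horizon layered MDP with regularizer `ψ(p; s) = α * KL(p, πref(· | s))`.
The layers are numbered `1, …, H`, the first one is `{s₁}`, and transitions go from a layer to the
next one. The episode ends after layer `H`: there `P s a` is the zero vector (which follows from
`P_layer` and `layer_mem`). -/
structure KLRegularizedMDP (S A : Type*) [Fintype S] [Fintype A] where
  /-- horizon -/
  H : ℕ
  /-- index of the layer of a state -/
  layer : S → ℕ
  layer_mem : ∀ s, layer s ∈ Finset.Icc 1 H
  /-- initial state -/
  s₁ : S
  layer_eq_one : ∀ s, layer s = 1 ↔ s = s₁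
  /-- transition probabilities -/
  P : S → A → S → ℝ
  P_nonneg : ∀ s a s', 0 ≤ P s a s'
  P_layer : ∀ s a s', 0 < P s a s' → layer s' = layer s + 1
  P_sum : ∀ s a, layer s < H → ∑ s', P s a s' = 1
  /-- mean reward -/
  R : S → A → ℝ
  R_mem : ∀ s a, R s a ∈ Set.Icc (0 : ℝ) 1
  /-- weight of the regularization -/
  α : ℝ
  α_pos : 0 < α
  /-- reference policy -/
  πref : Policy S A
  πref_pos : ∀ s a, 0 < (πref s).1 a

namespace KLRegularizedMDP

variable {S A : Type*} [Fintype S] [Fintype A] (M : KLRegularizedMDP S A)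

/-- The regularizer `ψ(p; s)`. -/
def ψ (p : stdSimplex ℝ A) (s : S) : ℝ := M.α * klFin p (M.πref s)

open Classical in
/-- Probability that the state is `t` after `k` transitions under `π`, when starting from `s`. -/
def stepProb (π : Policy S A) : ℕ → S → S → ℝ
  | 0, s, t => if s = t then 1 else 0
  | k + 1, s, t => ∑ a, (π s).1 a * ∑ u, M.P s a u * stepProb π k u t

/-- Regularized state value `V^π(s)`: the expectation, over trajectories that start from `s` and
follow `π` up to the end of the episode, of the sum of `R(s_h, a_h) - ψ(π(· | s_h); s_h)`.
After the last layer all step probabilities are zero. -/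
def value (π : Policy S A) (s : S) : ℝ :=
  ∑ k ∈ Finset.range M.H, ∑ t, M.stepProb π k s t * (∑ a, (π t).1 a * M.R t a - M.ψ (π t) t)

/-- Regularized state-action value `Q^π(s, a)`. -/
def qValue (π : Policy S A) (s : S) (a : A) : ℝ :=
  M.R s a + ∑ s', M.P s a s' * M.value π s'

/-- `J(π) = V^π(s₁)`. -/
def J (π : Policy S A) : ℝ := M.value π M.s₁

/-- `Q⋆(s, a) = max_π Q^π(s, a)`. -/
def qStar (s : S) (a : A) : ℝ := ⨆ π : Policy S A, M.qValue π s a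

/-- `π ∈ argmax J`. -/
def IsOptimal (π : Policy S A) : Prop := ∀ π', M.J π' ≤ M.J π

/-- State occupancy `d^π(s)`; it sums to `H` over all states. -/
def occ (π : Policy S A) (s : S) : ℝ := ∑ k ∈ Finset.range M.H, M.stepProb π k M.s₁ s

/-- Coverage `C^π = max_{s,a} d^π(s, a) / (H μ(s, a))`, where `d^π(s, a) = d^π(s) π(a | s)`. It is
`⊤` if `d^π(s, a) > 0 = μ(s, a)` for some `(s, a)`; pairs with `d^π(s, a) = μ(s, a) = 0` count as
`0`. -/
def coverage (μ : stdSimplex ℝ (S × A)) (π : Policy S A) : ENNReal :=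
  ⨆ (s : S) (a : A),
    ENNReal.ofReal (M.occ π s * (π s).1 a) / ENNReal.ofReal (M.H * μ.1 (s, a))

/-- `f(s) = max_p { E_{a ∼ p}[f(s, a)] - ψ(p; s) }`. -/
def softValue (f : S → A → ℝ) (s : S) : ℝ :=
  ⨆ p : stdSimplex ℝ A, (∑ a, p.1 a * f s a - M.ψ p s)

/-- `π` is a greedy policy `π_f` of `f`: for every `s`, `π(· | s)` is a maximizer of
`E_{a ∼ p}[f(s, a)] - ψ(p; s)`. -/
def IsGreedy (f : S → A → ℝ) (π : Policy S A) : Prop :=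
  ∀ (s : S) (p : stdSimplex ℝ A),
    ∑ a, p.1 a * f s a - M.ψ p s ≤ ∑ a, (π s).1 a * f s a - M.ψ (π s) s

/-- Bellman optimality operator `T f`. -/
def bellman (f : S → A → ℝ) (s : S) (a : A) : ℝ :=
  M.R s a + ∑ s', M.P s a s' * M.softValue f s'

/-- `μ` is admissible: for `1 ≤ h < H` and `s'` in layer `h + 1`,
`∑_{s in layer h, a} μ(s, a) P(s' | s, a) = μ(s')`, where `μ(s') = ∑ a, μ(s', a)`. -/
def Admissible (μ : stdSimplex ℝ (S × A)) : Prop :=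
  ∀ h, 1 ≤ h → h < M.H → ∀ s', M.layer s' = h + 1 →
    ∑ s with M.layer s = h, ∑ a, μ.1 (s, a) * M.P s a s' = ∑ a, μ.1 (s', a)

end KLRegularizedMDP

/-- An observation `(s, a, r, s')`. The next state is `none` if the episode ends. -/
abbrev Observation (S A : Type*) := S × A × ℝ × Option S

/-- All sets of next states are measurable (the state space is finite). -/
instance optionMeasurableSpace {S : Type*} : MeasurableSpace (Option S) := ⊤

namespace KLRegularizedMDP

variable {S A : Type*} [Fintype S] [Fintype A] (M : KLRegularizedMDP S A)

/-- `ν` is a law of one observation: `(s, a) ∼ μ`, `s' ∼ P(· | s, a)`, `r ∈ [0, 1]` almost surely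
and `E[r | s, a] = R(s, a)`. -/
structure IsSamplingLaw [MeasurableSpace S] [MeasurableSpace A] (μ : stdSimplex ℝ (S × A))
    (ν : Measure (Observation S A)) : Prop where
  state_action : ∀ s a, ν {z | z.1 = s ∧ z.2.1 = a} = ENNReal.ofReal (μ.1 (s, a))
  next_state : ∀ s a s', ν {z | z.1 = s ∧ z.2.1 = a ∧ z.2.2.2 = some s'} =
    ENNReal.ofReal (μ.1 (s, a) * M.P s a s')
  reward_mem : ∀ᵐ z ∂ν, z.2.2.1 ∈ Set.Icc (0 : ℝ) 1
  reward_mean : ∀ s a, ∫ z in {z | z.1 = s ∧ z.2.1 = a}, z.2.2.1 ∂ν = μ.1 (s, a) * M.R s a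

/-- `f(s')` for an observed next state, with value `0` after the end of the episode. -/
def nextValue (f : S → A → ℝ) (o : Option S) : ℝ := o.elim 0 (M.softValue f)

/-- `E_{(s,a,r,s') ∼ D}[(g(s, a) - r - f(s'))²]`. -/
def regressionLoss {n : ℕ} (D : Fin n → Observation S A) (f g : S → A → ℝ) : ℝ :=
  (1 / n : ℝ) * ∑ i, (g (D i).1 (D i).2.1 - (D i).2.2.1 - M.nextValue f (D i).2.2.2) ^ 2

/-- `That f` is, for every `f ∈ F`, a minimizer over `g ∈ G` of the regression loss. -/
def IsRegression {n : ℕ} (F G : Finset (S → A → ℝ)) (D : Fin n → Observation S A)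
    (That : (S → A → ℝ) → (S → A → ℝ)) : Prop :=
  ∀ f ∈ F, That f ∈ G ∧ ∀ g ∈ G, M.regressionLoss D f (That f) ≤ M.regressionLoss D f g

/-- The CQL objective
`E_{(s,a) ∼ D}[f(s) - f(s, a)] + lam * E_{(s,a) ∼ D}[(f(s, a) - (That f)(s, a))²]`. -/
def cqlLoss {n : ℕ} (lam : ℝ) (D : Fin n → Observation S A)
    (That : (S → A → ℝ) → (S → A → ℝ)) (f : S → A → ℝ) : ℝ :=
  (1 / n : ℝ) * ∑ i, (M.softValue f (D i).1 - f (D i).1 (D i).2.1) +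
    lam * ((1 / n : ℝ) * ∑ i, (f (D i).1 (D i).2.1 - That f (D i).1 (D i).2.1) ^ 2)

/-- `fhat` is an output of CQL on the data set `D`, for some choice of the minimizers. -/
def IsCQL {n : ℕ} (F G : Finset (S → A → ℝ)) (lam : ℝ) (D : Fin n → Observation S A)
    (fhat : S → A → ℝ) : Prop :=
  ∃ That, M.IsRegression F G D That ∧ fhat ∈ F ∧
    ∀ f ∈ F, M.cqlLoss lam D That fhat ≤ M.cqlLoss lam D That f

end KLRegularizedMDP

end

/-! KL regularization makes every greedy policy a Gibbs policy, here `softmax f`, and the Gibbs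
identity `sum_mul_sub_ψ` says exactly how much a policy loses at a state: α times its divergence
from the softmax. Write V_f for `softValue f`, T for the Bellman operator, d and π⋆ for the
occupancy and policy of the optimum, and W = ∑ d KL(π⋆ ‖ π_f). Summing the identity along π⋆ gives
V_f(s₁) - J(π⋆) = ∑ d (f - Tf) + α W (`softValue_sub_J`).

Admissibility gives μ a flow equation as well, so H times the μ-mean of the conservatism term,
measured relative to Q⋆, telescopes to V_f(s₁) - V_{Q⋆}(s₁) - H E_μ[f - Tf]. Eliminating V_f(s₁)
expresses α W as H times that conservatism gap plus the difference of the Bellman errors of f under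
Hμ and under d. Comparing the CQL objective at f and at Q⋆, whose Bellman error vanishes, bounds the
gap by statistical terms minus (λ/4) E_μ[(f - Tf)²] (`Concentrated.dataMean_le`). AM-GM and coverage
let this negative square absorb the difference of Bellman errors, at the price of a multiple of H C
/ λ. Hence W is small (`Concentrated.sum_occ_klFin_le`).

It remains to bound the regret linearly in W; Pinsker's inequality would give only a square root.
The regret is a sum of α KL(π_f ‖ π_{Q⋆}) along π_f, with both the trajectory and the divergence the
wrong way round. The divergence is reversed by bounded log-ratios (`klFin_le_mul_klFin_swap`). The
trajectory is changed to that of π⋆ by a logarithmic transform of the regret and the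
Donsker-Varadhan inequality (`le_of_recursion_change`), at a cost linear in KL. -/

noncomputable section

/-! ### Kullback-Leibler divergence on a finite set -/

section FiniteKL

variable {A : Type*} [Fintype A]

theorem univ_nonempty_of_stdSimplex (p : stdSimplex ℝ A) : (Finset.univ : Finset A).Nonempty := by
  by_contra h
  rw [Finset.not_nonempty_iff_eq_empty] at h
  have := p.2.2
  simp [h] at this

/-- `klFin` in terms of the nonnegative function `klFun x = x * log x + 1 - x`. -/
theorem klFin_eq_sum_klFun (p q : stdSimplex ℝ A) (hq : ∀ a, 0 < q.1 a) :
    klFin p q = ∑ a, q.1 a * InformationTheory.klFun (p.1 a / q.1 a) := by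
  have h : ∀ a, q.1 a * InformationTheory.klFun (p.1 a / q.1 a) =
      p.1 a * Real.log (p.1 a / q.1 a) + (q.1 a - p.1 a) := fun a => by
    have := (hq a).ne'
    rw [InformationTheory.klFun_apply]
    field_simp
    ring
  simp_rw [h, Finset.sum_add_distrib, Finset.sum_sub_distrib, p.2.2, q.2.2]
  simp [klFin]

theorem klFin_nonneg (p q : stdSimplex ℝ A) (hq : ∀ a, 0 < q.1 a) : 0 ≤ klFin p q := by
  rw [klFin_eq_sum_klFun p q hq]
  exact Finset.sum_nonneg fun a _ => mul_nonneg (hq a).le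
    (InformationTheory.klFun_nonneg (div_nonneg (p.2.1 a) (hq a).le))

theorem eq_of_klFin_eq_zero {p q : stdSimplex ℝ A} (hq : ∀ a, 0 < q.1 a) (h : klFin p q = 0) :
    p = q := by
  rw [klFin_eq_sum_klFun p q hq, Finset.sum_eq_zero_iff_of_nonneg fun a _ => mul_nonneg (hq a).le
    (InformationTheory.klFun_nonneg (div_nonneg (p.2.1 a) (hq a).le))] at h
  refine Subtype.ext (funext fun a => ?_)
  have h1 := (mul_eq_zero.1 (h a (Finset.mem_univ a))).resolve_left (hq a).ne'
  rw [InformationTheory.klFun_eq_zero_iff (div_nonneg (p.2.1 a) (hq a).le),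
    div_eq_one_iff_eq (hq a).ne'] at h1
  exact h1

theorem klFin_self (p : stdSimplex ℝ A) (hp : ∀ a, 0 < p.1 a) : klFin p p = 0 :=
  Finset.sum_eq_zero fun a _ => by simp [div_self (hp a).ne']

/-- The right side equals 1 at s = 0 and has derivative s (1 - exp (-s)) ≥ 0. This is the case of
negative log-ratio in the comparison of the two divergences. -/
theorem one_le_one_add_mul_exp_neg_add {s : ℝ} (hs : 0 ≤ s) :
    1 ≤ (1 + s) * Real.exp (-s) + s ^ 2 / 2 := by
  have hd : ∀ x : ℝ, HasDerivAt (fun s : ℝ => (1 + s) * Real.exp (-s) + s ^ 2 / 2)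
      (x * (1 - Real.exp (-x))) x := fun x => by
    have h1 := ((hasDerivAt_id x).const_add 1).mul ((hasDerivAt_id x).neg.exp)
    have h2 := ((hasDerivAt_id x).pow 2).div_const 2
    refine (h1.add h2).congr_deriv ?_
    simp
    ring
  have hm : MonotoneOn (fun s : ℝ => (1 + s) * Real.exp (-s) + s ^ 2 / 2) (Set.Ici 0) := by
    refine monotoneOn_of_deriv_nonneg (convex_Ici 0)
      (fun x _ => (hd x).continuousAt.continuousWithinAt)
      (fun x _ => (hd x).differentiableAt.differentiableWithinAt) fun x hx => ?_
    rw [interior_Ici] at hx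
    rw [(hd x).deriv]
    have : Real.exp (-x) ≤ 1 := Real.exp_le_one_iff.2 (neg_nonpos.2 (le_of_lt hx))
    exact mul_nonneg (le_of_lt hx) (sub_nonneg.2 this)
  simpa using hm (Set.self_mem_Ici) hs hs

/-- Comparison of the integrands of the two Kullback-Leibler divergences, with `x = exp t`. -/
theorem exp_mul_sub_exp_add_one_le (t : ℝ) :
    Real.exp t * t - Real.exp t + 1 ≤ (1 + |t|) * (Real.exp t - 1 - t) := by
  rcases le_total 0 t with ht | ht
  · rw [abs_of_nonneg ht]
    nlinarith [Real.quadratic_le_exp_of_nonneg ht]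
  · rw [abs_of_nonpos ht]
    have h := one_le_one_add_mul_exp_neg_add (neg_nonneg.2 ht)
    rw [neg_neg] at h
    linarith

/-- Reversal of the Kullback-Leibler divergence under a bound on the log-ratio. -/
theorem klFin_le_mul_klFin_swap (p q : stdSimplex ℝ A) (hp : ∀ a, 0 < p.1 a)
    (hq : ∀ a, 0 < q.1 a) {L : ℝ} (hL : ∀ a, |Real.log (p.1 a / q.1 a)| ≤ L) :
    klFin p q ≤ (1 + L) * klFin q p := by
  -- Adding p - q or its negative, which sums to zero, makes both integrands nonnegative, so that
  -- they can be compared term by term.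
  have e1 : klFin p q =
      ∑ a, (p.1 a * Real.log (p.1 a / q.1 a) - p.1 a + q.1 a) := by
    rw [Finset.sum_add_distrib, Finset.sum_sub_distrib, p.2.2, q.2.2]; simp [klFin]
  have e2 : klFin q p =
      ∑ a, (p.1 a - q.1 a - q.1 a * Real.log (p.1 a / q.1 a)) := by
    rw [Finset.sum_sub_distrib, Finset.sum_sub_distrib, p.2.2, q.2.2, klFin]
    rw [sub_self, zero_sub, ← Finset.sum_neg_distrib]
    refine Finset.sum_congr rfl fun a _ => ?_
    rw [← inv_div, Real.log_inv]; ring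
  rw [e1, e2, Finset.mul_sum]
  refine Finset.sum_le_sum fun a _ => ?_
  set t := Real.log (p.1 a / q.1 a) with ht
  have hexp : p.1 a = q.1 a * Real.exp t := by
    rw [ht, Real.exp_log (div_pos (hp a) (hq a)), mul_div_cancel₀ _ (hq a).ne']
  have h1 := exp_mul_sub_exp_add_one_le t
  have h2 : (1 + |t|) * (Real.exp t - 1 - t) ≤ (1 + L) * (Real.exp t - 1 - t) := by
    have := Real.add_one_le_exp t
    exact mul_le_mul_of_nonneg_right (by linarith [hL a]) (by linarith)
  have h3 := mul_le_mul_of_nonneg_left (h1.trans h2) (hq a).le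
  rw [hexp]
  linarith

/-- Jensen's inequality with a change of measure (Donsker-Varadhan). -/
theorem sum_mul_log_sub_klFin_le (p q : stdSimplex ℝ A) (hq : ∀ a, 0 < q.1 a)
    (y : A → ℝ) (hy : ∀ a, 0 < y a) :
    ∑ a, p.1 a * Real.log (y a) - klFin p q ≤ Real.log (∑ a, q.1 a * y a) := by
  have hne := univ_nonempty_of_stdSimplex p
  set Z := ∑ a, q.1 a * y a with hZ
  have hZpos : 0 < Z := Finset.sum_pos (fun a _ => mul_pos (hq a) (hy a)) hne
  -- This is log z ≤ z - 1 at z = q y / (Z p), weighted by p; the right sides sum to zero.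
  have key : ∀ a, p.1 a * Real.log (y a) - p.1 a * Real.log (p.1 a / q.1 a) - p.1 a * Real.log Z ≤
      q.1 a * y a / Z - p.1 a := by
    intro a
    rcases (p.2.1 a).eq_or_lt with h0 | h0
    · rw [← h0]
      simpa using (div_pos (mul_pos (hq a) (hy a)) hZpos).le
    · have := Real.log_le_sub_one_of_pos (show 0 < q.1 a * y a / Z / p.1 a from
        div_pos (div_pos (mul_pos (hq a) (hy a)) hZpos) h0)
      rw [Real.log_div (div_pos (mul_pos (hq a) (hy a)) hZpos).ne' h0.ne',
        Real.log_div (mul_pos (hq a) (hy a)).ne' hZpos.ne',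
        Real.log_mul (hq a).ne' (hy a).ne'] at this
      rw [Real.log_div h0.ne' (hq a).ne']
      have h2 := mul_le_mul_of_nonneg_left this h0.le
      have h3 : p.1 a * (q.1 a * y a / Z / p.1 a - 1) = q.1 a * y a / Z - p.1 a := by
        field_simp
      linarith
  have hs := Finset.sum_le_sum fun a (_ : a ∈ Finset.univ) => key a
  simp only [Finset.sum_sub_distrib, ← Finset.sum_mul, ← Finset.sum_div, p.2.2] at hs
  rw [← hZ, div_self hZpos.ne'] at hs
  rw [klFin]
  linarith

end FiniteKL

namespace KLRegularizedMDP

variable {S A : Type*} [Fintype S] [Fintype A] (M : KLRegularizedMDP S A)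

/-! ### Transitions and occupancies -/

/-- Expected value of `g` at the next state, under `π`. -/
def transOp (π : Policy S A) (g : S → ℝ) (s : S) : ℝ :=
  ∑ a, (π s).1 a * ∑ u, M.P s a u * g u

/-- Expected one-step regularized reward. -/
def stepReward (π : Policy S A) (s : S) : ℝ := ∑ a, (π s).1 a * M.R s a - M.ψ (π s) s

/-- Expectation of `g` after `k` transitions. -/
def stepMean (π : Policy S A) (k : ℕ) (g : S → ℝ) (s : S) : ℝ := ∑ t, M.stepProb π k s t * g t

theorem one_le_H : 1 ≤ M.H := by
  have := Finset.mem_Icc.1 (M.layer_mem M.s₁)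
  omega

theorem one_le_H_real : (1 : ℝ) ≤ M.H := by exact_mod_cast M.one_le_H

theorem layer_le (s : S) : M.layer s ≤ M.H := (Finset.mem_Icc.1 (M.layer_mem s)).2

theorem one_le_layer (s : S) : 1 ≤ M.layer s := (Finset.mem_Icc.1 (M.layer_mem s)).1

theorem layer_s₁ : M.layer M.s₁ = 1 := (M.layer_eq_one _).2 rfl

theorem P_eq_zero {s u : S} (a : A) (h : M.layer u ≠ M.layer s + 1) : M.P s a u = 0 := by
  by_contra h0
  exact h (M.P_layer s a u (lt_of_le_of_ne (M.P_nonneg s a u) (Ne.symm h0)))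

/-- Induction over the layers, backward from the last one. -/
theorem layer_induction {p : S → Prop}
    (h : ∀ s, (∀ u, M.layer u = M.layer s + 1 → p u) → p s) (s : S) : p s := by
  have key : ∀ k s, M.layer s + k = M.H → p s := by
    intro k
    induction k with
    | zero => exact fun s hs => h s fun u hu => by have := M.layer_le u; omega
    | succ k ih => exact fun s hs => h s fun u hu => ih u (by omega)
  exact key (M.H - M.layer s) s (by have := M.layer_le s; omega)

theorem sum_P_mul_congr (s : S) (a : A) {g g' : S → ℝ}
    (h : ∀ u, M.layer u = M.layer s + 1 → g u = g' u) :
    ∑ u, M.P s a u * g u = ∑ u, M.P s a u * g' u := by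
  refine Finset.sum_congr rfl fun u _ => ?_
  by_cases hu : M.layer u = M.layer s + 1
  · rw [h u hu]
  · rw [M.P_eq_zero a hu]; simp

theorem sum_P_mul_le_sum (s : S) (a : A) {g g' : S → ℝ}
    (h : ∀ u, M.layer u = M.layer s + 1 → g u ≤ g' u) :
    ∑ u, M.P s a u * g u ≤ ∑ u, M.P s a u * g' u := by
  refine Finset.sum_le_sum fun u _ => ?_
  by_cases hu : M.layer u = M.layer s + 1
  · exact mul_le_mul_of_nonneg_left (h u hu) (M.P_nonneg s a u)
  · rw [M.P_eq_zero a hu]; simp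

theorem sum_P_of_layer_eq {s : S} (a : A) (hs : M.layer s = M.H) (g : S → ℝ) :
    ∑ u, M.P s a u * g u = 0 :=
  Finset.sum_eq_zero fun u _ => by
    rw [M.P_eq_zero a (by have := M.layer_le u; omega), zero_mul]

theorem sum_P_le_one (s : S) (a : A) : ∑ u, M.P s a u ≤ 1 := by
  rcases (M.layer_le s).lt_or_eq with h | h
  · exact (M.P_sum s a h).le
  · have := M.sum_P_of_layer_eq a h fun _ => 1
    simp only [mul_one] at this
    rw [this]; exact zero_le_one

theorem sum_P_mul_nonneg (s : S) (a : A) {g : S → ℝ} (h : ∀ u, 0 ≤ g u) :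
    0 ≤ ∑ u, M.P s a u * g u :=
  Finset.sum_nonneg fun u _ => mul_nonneg (M.P_nonneg s a u) (h u)

theorem sum_P_mul_le (s : S) (a : A) {g : S → ℝ} {c : ℝ} (hc : 0 ≤ c) (h : ∀ u, g u ≤ c) :
    ∑ u, M.P s a u * g u ≤ c := by
  refine (M.sum_P_mul_le_sum s a (g' := fun _ => c) fun u _ => h u).trans ?_
  rw [← Finset.sum_mul]
  exact mul_le_of_le_one_left hc (M.sum_P_le_one s a)

theorem transOp_le_transOp (π : Policy S A) (s : S) {g g' : S → ℝ}
    (h : ∀ u, M.layer u = M.layer s + 1 → g u ≤ g' u) :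
    M.transOp π g s ≤ M.transOp π g' s :=
  Finset.sum_le_sum fun a _ =>
    mul_le_mul_of_nonneg_left (M.sum_P_mul_le_sum s a h) ((π s).2.1 a)

theorem transOp_congr (π : Policy S A) (s : S) {g g' : S → ℝ}
    (h : ∀ u, M.layer u = M.layer s + 1 → g u = g' u) :
    M.transOp π g s = M.transOp π g' s :=
  le_antisymm (M.transOp_le_transOp π s fun u hu => (h u hu).le)
    (M.transOp_le_transOp π s fun u hu => (h u hu).ge)

theorem transOp_sub (π : Policy S A) (g g' : S → ℝ) (s : S) :
    M.transOp π (fun u => g u - g' u) s = M.transOp π g s - M.transOp π g' s := by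
  simp only [transOp, mul_sub, Finset.sum_sub_distrib]

theorem stepProb_nonneg (π : Policy S A) (k : ℕ) (s t : S) : 0 ≤ M.stepProb π k s t := by
  induction k generalizing s with
  | zero => rw [stepProb]; split_ifs <;> norm_num
  | succ k ih =>
    exact Finset.sum_nonneg fun a _ => mul_nonneg ((π s).2.1 a)
      (M.sum_P_mul_nonneg s a fun u => ih u)

theorem stepProb_eq_zero (π : Policy S A) (k : ℕ) (s t : S) (h : M.layer t ≠ M.layer s + k) :
    M.stepProb π k s t = 0 := by
  induction k generalizing s with
  | zero =>
    rw [stepProb, if_neg]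
    rintro rfl
    simp at h
  | succ k ih =>
    rw [stepProb]
    refine Finset.sum_eq_zero fun a _ => ?_
    rw [M.sum_P_mul_congr s a (g' := fun _ => 0) fun u hu => ih u (by omega)]
    simp

theorem occ_nonneg (π : Policy S A) (s : S) : 0 ≤ M.occ π s :=
  Finset.sum_nonneg fun _ _ => M.stepProb_nonneg π _ _ _

theorem stepMean_zero (π : Policy S A) (g : S → ℝ) : M.stepMean π 0 g = g := by
  classical
  funext s
  simp [stepMean, stepProb]

theorem stepMean_succ (π : Policy S A) (k : ℕ) (g : S → ℝ) :
    M.stepMean π (k + 1) g = M.transOp π (M.stepMean π k g) := by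
  funext s
  simp only [stepMean, stepProb, transOp, Finset.mul_sum, Finset.sum_mul]
  rw [Finset.sum_comm]
  refine Finset.sum_congr rfl fun a _ => ?_
  rw [Finset.sum_comm]
  exact Finset.sum_congr rfl fun u _ => Finset.sum_congr rfl fun t _ => by ring

/-- `stepProb` peels off the first transition, whereas telescoping an occupancy needs the last one.
-/
theorem stepMean_succ' (π : Policy S A) (k : ℕ) (g : S → ℝ) :
    M.stepMean π (k + 1) g = M.stepMean π k (M.transOp π g) := by
  induction k with
  | zero => rw [stepMean_succ, stepMean_zero, stepMean_zero]
  | succ k ih => rw [stepMean_succ, ih, ← stepMean_succ]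

theorem stepMean_H (π : Policy S A) (g : S → ℝ) (s : S) : M.stepMean π M.H g s = 0 :=
  Finset.sum_eq_zero fun t _ => by
    rw [M.stepProb_eq_zero π _ _ _ (by have := M.layer_le t; have := M.one_le_layer s; omega),
      zero_mul]

/-- Flow equation of the occupancy. -/
theorem sum_occ_mul_sub_transOp (π : Policy S A) (g : S → ℝ) :
    ∑ s, M.occ π s * (g s - M.transOp π g s) = g M.s₁ := by
  have h : ∑ s, M.occ π s * (g s - M.transOp π g s) =
      ∑ k ∈ Finset.range M.H, (M.stepMean π k g M.s₁ - M.stepMean π (k + 1) g M.s₁) := by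
    simp only [occ, Finset.sum_mul]
    rw [Finset.sum_comm]
    refine Finset.sum_congr rfl fun k _ => ?_
    rw [stepMean_succ', stepMean, stepMean, ← Finset.sum_sub_distrib]
    exact Finset.sum_congr rfl fun t _ => by ring
  rw [h, Finset.sum_range_sub', stepMean_H, stepMean_zero, sub_zero]

theorem value_eq_sum_stepMean (π : Policy S A) (s : S) :
    M.value π s = ∑ k ∈ Finset.range M.H, M.stepMean π k (M.stepReward π) s := rfl

/-- Bellman equation of a policy. -/
theorem value_eq (π : Policy S A) (s : S) :
    M.value π s = M.stepReward π s + M.transOp π (M.value π) s := by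
  have h : M.transOp π (M.value π) s =
      ∑ k ∈ Finset.range M.H, M.stepMean π (k + 1) (M.stepReward π) s := by
    simp only [stepMean_succ]
    simp only [transOp, value_eq_sum_stepMean, Finset.mul_sum]
    symm
    rw [Finset.sum_comm]
    refine Finset.sum_congr rfl fun a _ => ?_
    rw [Finset.sum_comm]
  have h0 : M.stepReward π s = M.stepMean π 0 (M.stepReward π) s := by rw [stepMean_zero]
  -- The vanishing term k = H is added to the sum over k < H, and then the term k = 0 is split off.
  rw [h, h0, ← add_zero (M.value π s), ← M.stepMean_H π (M.stepReward π) s,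
    value_eq_sum_stepMean, ← Finset.sum_range_succ, Finset.sum_range_succ', add_comm]

/-- The number of remaining layers drops by one at every step, including the last layer, where it is
1 and the transition vector is zero. As a test function in a flow equation it computes total mass.
-/
theorem sum_P_remaining (s : S) (a : A) :
    (M.H + 1 - M.layer s : ℝ) - ∑ u, M.P s a u * (M.H + 1 - M.layer u : ℝ) = 1 := by
  rcases (M.layer_le s).lt_or_eq with h | h
  · rw [M.sum_P_mul_congr s a (g' := fun _ => (M.H - M.layer s : ℝ)) fun u hu => by
      rw [hu]; push_cast; ring, ← Finset.sum_mul, M.P_sum s a h]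
    ring
  · rw [M.sum_P_of_layer_eq a h, h]; ring

theorem sum_occ (π : Policy S A) : ∑ s, M.occ π s = M.H := by
  have h := M.sum_occ_mul_sub_transOp π fun s => (M.H + 1 - M.layer s : ℝ)
  simp only [layer_s₁] at h
  have h1 : ∀ s, (M.H + 1 - M.layer s : ℝ) -
      M.transOp π (fun s => (M.H + 1 - M.layer s : ℝ)) s = 1 := fun s => by
    have : ∀ a, ∑ u, M.P s a u * (M.H + 1 - M.layer u : ℝ) = (M.H + 1 - M.layer s : ℝ) - 1 :=
      fun a => by linarith [M.sum_P_remaining s a]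
    simp only [transOp, this, ← Finset.sum_mul, (π s).2.2]
    ring
  simp only [h1] at h
  simp at h
  exact h

/-! ### Admissible data distributions -/

variable {M} in
/-- Flow equation of an admissible distribution, up to the mass of the initial state. -/
theorem Admissible.sum_mul_sub_eq_marginal {μ : stdSimplex ℝ (S × A)} (hμ : M.Admissible μ)
    (g : S → ℝ) :
    ∑ s, ∑ a, μ.1 (s, a) * (g s - ∑ u, M.P s a u * g u) = (∑ a, μ.1 (M.s₁, a)) * g M.s₁ := by
  classical
  -- Nothing flows into layer 1, and every other state receives mass only from the preceding layer,
  -- where admissibility applies.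
  have hflow : ∀ u, ∑ s, ∑ a, μ.1 (s, a) * M.P s a u =
      if u = M.s₁ then 0 else ∑ a, μ.1 (u, a) := by
    intro u
    have hu1 := M.one_le_layer u
    have huH := M.layer_le u
    split_ifs with hu
    · refine Finset.sum_eq_zero fun s _ => Finset.sum_eq_zero fun a _ => ?_
      have h1 := (M.layer_eq_one u).2 hu
      rw [M.P_eq_zero a (by have := M.one_le_layer s; omega), mul_zero]
    · have h1 : M.layer u ≠ 1 := fun h => hu ((M.layer_eq_one u).1 h)
      rw [← hμ (M.layer u - 1) (by omega) (by omega) u (by omega)]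
      rw [← Finset.sum_filter_add_sum_filter_not Finset.univ
        (fun s => M.layer s = M.layer u - 1)]
      rw [add_eq_left]
      refine Finset.sum_eq_zero fun s hs => Finset.sum_eq_zero fun a _ => ?_
      have := (Finset.mem_filter.1 hs).2
      rw [M.P_eq_zero a (by omega), mul_zero]
  have h1 : ∑ s, ∑ a, μ.1 (s, a) * ∑ u, M.P s a u * g u =
      ∑ u, (∑ s, ∑ a, μ.1 (s, a) * M.P s a u) * g u := by
    simp only [Finset.sum_mul, Finset.mul_sum]
    symm
    rw [Finset.sum_comm]
    refine Finset.sum_congr rfl fun s _ => ?_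
    rw [Finset.sum_comm]
    exact Finset.sum_congr rfl fun a _ => Finset.sum_congr rfl fun u _ => by ring
  simp only [mul_sub, Finset.sum_sub_distrib, h1, hflow, ← Finset.sum_mul]
  rw [← Finset.sum_sub_distrib, Finset.sum_eq_single M.s₁]
  · simp
  · intro s _ hs
    rw [if_neg hs, sub_self]
  · simp

variable {M} in
/-- Flow equation of an admissible distribution. -/
theorem Admissible.sum_mul_sub {μ : stdSimplex ℝ (S × A)} (hμ : M.Admissible μ)
    (g : S → ℝ) :
    M.H * ∑ s, ∑ a, μ.1 (s, a) * (g s - ∑ u, M.P s a u * g u) = g M.s₁ := by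
  -- This test function has value H at the initial state and unit decrement, so H μ(s₁) is the total
  -- mass 1.
  have h := hμ.sum_mul_sub_eq_marginal fun s => (M.H + 1 - M.layer s : ℝ)
  simp only [M.sum_P_remaining, mul_one, layer_s₁] at h
  rw [← Fintype.sum_prod_type', μ.2.2] at h
  rw [hμ.sum_mul_sub_eq_marginal, ← mul_assoc]
  have : (M.H : ℝ) * ∑ a, μ.1 (M.s₁, a) = 1 := by
    rw [h]; push_cast; ring
  rw [this, one_mul]

end KLRegularizedMDP

namespace KLRegularizedMDP

variable {S A : Type*} [Fintype S] [Fintype A] (M : KLRegularizedMDP S A)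

/-! ### Greedy policies -/

/-- Normalization of the greedy policy of `f`. -/
def partition (f : S → A → ℝ) (s : S) : ℝ := ∑ a, (M.πref s).1 a * Real.exp (f s a / M.α)

theorem partition_pos (f : S → A → ℝ) (s : S) : 0 < M.partition f s :=
  Finset.sum_pos (fun a _ => mul_pos (M.πref_pos s a) (Real.exp_pos _)) (univ_nonempty_of_stdSimplex (M.πref s))

/-- The greedy policy of `f`. -/
def softmax (f : S → A → ℝ) : Policy S A := fun s =>
  ⟨fun a => (M.πref s).1 a * Real.exp (f s a / M.α) / M.partition f s,
    fun a => div_nonneg (mul_pos (M.πref_pos s a) (Real.exp_pos _)).le (M.partition_pos f s).le,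
    by rw [← Finset.sum_div]; exact div_self (M.partition_pos f s).ne'⟩

theorem softmax_apply (f : S → A → ℝ) (s : S) (a : A) :
    (M.softmax f s).1 a = (M.πref s).1 a * Real.exp (f s a / M.α) / M.partition f s := rfl

theorem softmax_pos (f : S → A → ℝ) (s : S) (a : A) : 0 < (M.softmax f s).1 a :=
  div_pos (mul_pos (M.πref_pos s a) (Real.exp_pos _)) (M.partition_pos f s)

/-- The log-density of the softmax against the reference is f / α minus the log-partition, so taking
it as the new reference turns the objective into a constant minus a divergence. -/
theorem sum_mul_sub_ψ_eq_log (f : S → A → ℝ) (p : stdSimplex ℝ A) (s : S) :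
    ∑ a, p.1 a * f s a - M.ψ p s =
      M.α * Real.log (M.partition f s) - M.α * klFin p (M.softmax f s) := by
  have hα := M.α_pos
  have h : ∀ a, p.1 a * Real.log (p.1 a / (M.softmax f s).1 a) =
      p.1 a * Real.log (p.1 a / (M.πref s).1 a) - p.1 a * (f s a) / M.α +
        p.1 a * Real.log (M.partition f s) := by
    intro a
    rcases (p.2.1 a).eq_or_lt with h0 | h0
    · rw [← h0]; simp
    · rw [Real.log_div h0.ne' (M.softmax_pos f s a).ne', softmax_apply,
        Real.log_div (mul_pos (M.πref_pos s a) (Real.exp_pos _)).ne' (M.partition_pos f s).ne',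
        Real.log_mul (M.πref_pos s a).ne' (Real.exp_pos _).ne', Real.log_exp,
        Real.log_div h0.ne' (M.πref_pos s a).ne']
      ring
  simp only [ψ, klFin, h, Finset.sum_add_distrib, Finset.sum_sub_distrib, ← Finset.sum_mul,
    ← Finset.sum_div, p.2.2]
  field_simp
  ring

theorem softValue_eq_log (f : S → A → ℝ) (s : S) :
    M.softValue f s = M.α * Real.log (M.partition f s) := by
  have : Nonempty (stdSimplex ℝ A) := ⟨M.πref s⟩
  have hb : ∀ p : stdSimplex ℝ A, ∑ a, p.1 a * f s a - M.ψ p s ≤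
      M.α * Real.log (M.partition f s) := fun p => by
    rw [sum_mul_sub_ψ_eq_log]
    have := mul_nonneg M.α_pos.le (klFin_nonneg p _ (M.softmax_pos f s))
    linarith
  refine le_antisymm (ciSup_le hb) ?_
  refine le_ciSup_of_le ⟨_, Set.forall_mem_range.2 hb⟩ (M.softmax f s) ?_
  rw [sum_mul_sub_ψ_eq_log, klFin_self _ (M.softmax_pos f s)]
  simp

/-- Gibbs variational identity. -/
theorem sum_mul_sub_ψ (f : S → A → ℝ) (p : stdSimplex ℝ A) (s : S) :
    ∑ a, p.1 a * f s a - M.ψ p s = M.softValue f s - M.α * klFin p (M.softmax f s) := by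
  rw [sum_mul_sub_ψ_eq_log, softValue_eq_log]

theorem softValue_congr {f g : S → A → ℝ} {s : S} (h : ∀ a, f s a = g s a) :
    M.softValue f s = M.softValue g s := by
  simp only [softValue, h]

variable {M} in
-- The maximizer is unique because the loss α KL vanishes only at the softmax.
theorem IsGreedy.eq_softmax {f : S → A → ℝ} {π : Policy S A} (h : M.IsGreedy f π) :
    π = M.softmax f := by
  funext s
  refine eq_of_klFin_eq_zero (M.softmax_pos f s) (le_antisymm ?_
    (klFin_nonneg _ _ (M.softmax_pos f s)))
  have := h s (M.softmax f s)
  rw [sum_mul_sub_ψ, sum_mul_sub_ψ, klFin_self _ (M.softmax_pos f s)] at this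
  have hα := M.α_pos
  by_contra h0
  have := mul_pos hα (not_le.1 h0)
  linarith

theorem softValue_mem_Icc {f : S → A → ℝ} {s : S} {B : ℝ} (hf : ∀ a, f s a ∈ Set.Icc 0 B) :
    M.softValue f s ∈ Set.Icc 0 B := by
  have hα := M.α_pos
  rw [softValue_eq_log]
  have h1 : 1 ≤ M.partition f s := by
    rw [← (M.πref s).2.2]
    refine Finset.sum_le_sum fun a _ => le_mul_of_one_le_right (M.πref_pos s a).le ?_
    exact Real.one_le_exp (div_nonneg (hf a).1 hα.le)
  have h2 : M.partition f s ≤ Real.exp (B / M.α) := by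
    rw [← one_mul (Real.exp (B / M.α)), ← (M.πref s).2.2, Finset.sum_mul]
    refine Finset.sum_le_sum fun a _ => mul_le_mul_of_nonneg_left ?_ (M.πref_pos s a).le
    exact Real.exp_le_exp.2 (div_le_div_of_nonneg_right (hf a).2 hα.le)
  refine ⟨mul_nonneg hα.le (Real.log_nonneg h1), ?_⟩
  have h3 := (Real.log_le_iff_le_exp (M.partition_pos f s)).2 h2
  rwa [le_div_iff₀ hα, mul_comm] at h3

/-- Log-ratios of greedy policies are differences of advantages, hence at most 2B / α in absolute
value for functions with values in [0, B]. -/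
theorem log_softmax_div_softmax (f g : S → A → ℝ) (s : S) (a : A) :
    M.α * Real.log ((M.softmax f s).1 a / (M.softmax g s).1 a) =
      (f s a - M.softValue f s) - (g s a - M.softValue g s) := by
  have h : ∀ f, M.α * Real.log ((M.softmax f s).1 a) =
      M.α * Real.log ((M.πref s).1 a) + (f s a - M.softValue f s) := fun f => by
    rw [softmax_apply, softValue_eq_log,
      Real.log_div (mul_pos (M.πref_pos s a) (Real.exp_pos _)).ne' (M.partition_pos f s).ne',
      Real.log_mul (M.πref_pos s a).ne' (Real.exp_pos _).ne', Real.log_exp]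
    have := M.α_pos.ne'
    field_simp
    ring
  rw [Real.log_div (M.softmax_pos f s a).ne' (M.softmax_pos g s a).ne', mul_sub, h, h]
  ring

/-! ### Optimal values -/

/-- Backward induction: the iterates settle at a layer one step after they settle at the next. The
last layer needs one iteration, so layer h needs H + 1 - h. -/
theorem bellman_iterate_stable (k : ℕ) (s : S) (a : A) (h : M.H < M.layer s + k) :
    M.bellman^[k + 1] 0 s a = M.bellman^[k] 0 s a := by
  induction k generalizing s a with
  | zero => have := M.layer_le s; omega
  | succ k ih =>
    rw [Function.iterate_succ_apply', Function.iterate_succ_apply' _ k]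
    refine congrArg (M.R s a + ·) (M.sum_P_mul_congr s a fun u hu => M.softValue_congr fun b => ?_)
    rw [← Function.iterate_succ_apply' M.bellman]
    exact ih u b (by omega)

theorem exists_bellman_fixedPoint : ∃ Q : S → A → ℝ, M.bellman Q = Q := by
  refine ⟨M.bellman^[M.H] 0, ?_⟩
  funext s a
  rw [← Function.iterate_succ_apply' M.bellman]
  exact M.bellman_iterate_stable _ s a (by have := M.one_le_layer s; omega)

/-- The greedy value of `f`, in terms of a policy and of the Bellman error of `f`. -/
theorem softValue_sub_transOp (f : S → A → ℝ) (π : Policy S A) (s : S) :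
    M.softValue f s - M.transOp π (M.softValue f) s = M.stepReward π s +
      ∑ a, (π s).1 a * (f s a - M.bellman f s a) + M.α * klFin (π s) (M.softmax f s) := by
  have h := M.sum_mul_sub_ψ f (π s) s
  simp only [transOp, stepReward, bellman, mul_sub, mul_add, Finset.sum_sub_distrib,
    Finset.sum_add_distrib] at h ⊢
  linarith

theorem value_sub_transOp (π : Policy S A) (s : S) :
    M.value π s - M.transOp π (M.value π) s = M.stepReward π s := by
  have := M.value_eq π s
  linarith

/-- Gap between the greedy value of `f` and the value of a policy. -/
theorem softValue_sub_J (f : S → A → ℝ) (π : Policy S A) :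
    M.softValue f M.s₁ - M.J π = ∑ s, M.occ π s *
      (∑ a, (π s).1 a * (f s a - M.bellman f s a) + M.α * klFin (π s) (M.softmax f s)) := by
  rw [J, ← M.sum_occ_mul_sub_transOp π fun s => M.softValue f s - M.value π s]
  refine Finset.sum_congr rfl fun s _ => ?_
  rw [transOp_sub]
  have h1 := M.softValue_sub_transOp f π s
  have h2 := M.value_sub_transOp π s
  congr 1
  linarith

/-- Recursion of the suboptimality of a policy. -/
theorem softValue_sub_value_eq {Q : S → A → ℝ} (hQ : M.bellman Q = Q) (π : Policy S A) (s : S) :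
    M.softValue Q s - M.value π s =
      M.transOp π (fun u => M.softValue Q u - M.value π u) s +
        M.α * klFin (π s) (M.softmax Q s) := by
  have h1 := M.softValue_sub_transOp Q π s
  have h2 := M.value_sub_transOp π s
  simp only [hQ, sub_self, mul_zero, Finset.sum_const_zero] at h1
  rw [transOp_sub]
  linarith

theorem value_le_softValue {Q : S → A → ℝ} (hQ : M.bellman Q = Q) (π : Policy S A) (s : S) :
    M.value π s ≤ M.softValue Q s := by
  induction s using M.layer_induction with
  | h s ih =>
    have h1 := M.softValue_sub_value_eq hQ π s
    have h2 := M.transOp_le_transOp π s (g := fun _ => 0)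
      (g' := fun u => M.softValue Q u - M.value π u) fun u hu => sub_nonneg.2 (ih u hu)
    have h3 := mul_nonneg M.α_pos.le (klFin_nonneg (π s) _ (M.softmax_pos Q s))
    have h4 : M.transOp π (fun _ => 0) s = 0 := by simp [transOp]
    linarith

theorem value_softmax {Q : S → A → ℝ} (hQ : M.bellman Q = Q) (s : S) :
    M.value (M.softmax Q) s = M.softValue Q s := by
  induction s using M.layer_induction with
  | h s ih =>
    have h1 := M.softValue_sub_value_eq hQ (M.softmax Q) s
    rw [klFin_self _ (M.softmax_pos Q s), M.transOp_congr _ s (g' := fun _ => 0)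
      fun u hu => by rw [ih u hu, sub_self]] at h1
    have h4 : M.transOp (M.softmax Q) (fun _ => 0) s = 0 := by simp [transOp]
    linarith

theorem qStar_eq {Q : S → A → ℝ} (hQ : M.bellman Q = Q) : M.qStar = Q := by
  funext s a
  have : Nonempty (Policy S A) := ⟨M.πref⟩
  have hb : ∀ π, M.qValue π s a ≤ Q s a := fun π => by
    rw [← congrFun (congrFun hQ s) a]
    exact add_le_add_right (M.sum_P_mul_le_sum s a fun u _ => M.value_le_softValue hQ π u) _
  refine le_antisymm (ciSup_le hb) (le_ciSup_of_le ⟨_, Set.forall_mem_range.2 hb⟩ (M.softmax Q) ?_)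
  have h : M.value (M.softmax Q) = M.softValue Q := funext fun s => M.value_softmax hQ s
  rw [qValue, h]
  exact (congrFun (congrFun hQ s) a).ge

theorem bellman_qStar : M.bellman M.qStar = M.qStar := by
  obtain ⟨Q, hQ⟩ := M.exists_bellman_fixedPoint
  rwa [M.qStar_eq hQ]

variable {M} in
theorem IsOptimal.J_eq {π : Policy S A} (h : M.IsOptimal π) :
    M.J π = M.softValue M.qStar M.s₁ := by
  refine le_antisymm (M.value_le_softValue M.bellman_qStar π _) ?_
  rw [← M.value_softmax M.bellman_qStar]
  exact h _

variable {M} in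
/-- An optimal policy is greedy with respect to `Q⋆` at the states that it visits. -/
theorem IsOptimal.eq_softmax_qStar {π : Policy S A} (h : M.IsOptimal π) {s : S}
    (hs : M.occ π s ≠ 0) : π s = M.softmax M.qStar s := by
  have h1 := M.softValue_sub_J M.qStar π
  simp only [h.J_eq, M.bellman_qStar, sub_self, mul_zero, Finset.sum_const_zero, zero_add] at h1
  have h2 := (Finset.sum_eq_zero_iff_of_nonneg fun s _ => mul_nonneg (M.occ_nonneg π s)
    (mul_nonneg M.α_pos.le (klFin_nonneg (π s) _ (M.softmax_pos M.qStar s)))).1 h1.symm s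
      (Finset.mem_univ s)
  exact eq_of_klFin_eq_zero (M.softmax_pos _ s)
    (((mul_eq_zero.1 h2).resolve_left hs |> mul_eq_zero.1).resolve_left M.α_pos.ne')

/-! ### Suboptimality of a greedy policy -/

theorem mul_klFin_softmax_le_range {f g : S → A → ℝ} {B : ℝ}
    (hf : ∀ s a, f s a ∈ Set.Icc 0 B) (hg : ∀ s a, g s a ∈ Set.Icc 0 B) (s : S) :
    M.α * klFin (M.softmax f s) (M.softmax g s) ≤ 2 * B := by
  rw [klFin, Finset.mul_sum]
  calc _ ≤ ∑ a, (M.softmax f s).1 a * (2 * B) := Finset.sum_le_sum fun a _ => by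
        rw [mul_left_comm, log_softmax_div_softmax]
        have h1 := hf s a
        have h2 := hg s a
        have h3 := M.softValue_mem_Icc (hf s)
        have h4 := M.softValue_mem_Icc (hg s)
        exact mul_le_mul_of_nonneg_left (by linarith [h1.2, h2.1, h3.1, h4.2])
          (M.softmax_pos f s a).le
    _ = 2 * B := by rw [← Finset.sum_mul, (M.softmax f s).2.2, one_mul]

theorem mul_klFin_softmax_le_swap {f g : S → A → ℝ} {B : ℝ}
    (hf : ∀ s a, f s a ∈ Set.Icc 0 B) (hg : ∀ s a, g s a ∈ Set.Icc 0 B) (s : S) :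
    M.α * klFin (M.softmax f s) (M.softmax g s) ≤
      (M.α + 2 * B) * klFin (M.softmax g s) (M.softmax f s) := by
  have hα := M.α_pos
  have h := klFin_le_mul_klFin_swap (M.softmax f s) (M.softmax g s) (M.softmax_pos f s)
    (M.softmax_pos g s) (L := 2 * B / M.α) fun a => by
      rw [le_div_iff₀ hα]
      rw [← abs_of_pos hα, ← abs_mul, mul_comm, log_softmax_div_softmax, abs_le]
      have h1 := hf s a
      have h2 := hg s a
      have h3 := M.softValue_mem_Icc (hf s)
      have h4 := M.softValue_mem_Icc (hg s)
      constructor <;> linarith [h1.1, h1.2, h2.1, h2.2, h3.1, h3.2, h4.1, h4.2]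
  refine (mul_le_mul_of_nonneg_left h hα.le).trans_eq ?_
  field_simp

/-- A recursion `U = P_π U + c` with `0 ≤ c ≤ B` is bounded by `B` times the horizon. -/
theorem le_of_recursion {π : Policy S A} {U c : S → ℝ} {B : ℝ}
    (hU : ∀ s, U s = M.transOp π U s + c s) (hc : ∀ s, c s ≤ B) (s : S) :
    U s ≤ B * (M.H + 1 - M.layer s) := by
  induction s using M.layer_induction with
  | h s ih =>
    have h1 := M.transOp_le_transOp π s ih
    have h2 : M.transOp π (fun u => B * (M.H + 1 - M.layer u : ℝ)) s =
        B * (M.H - M.layer s : ℝ) := by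
      have : ∀ a, ∑ u, M.P s a u * (B * (M.H + 1 - M.layer u : ℝ)) =
          B * (M.H - M.layer s : ℝ) := fun a => by
        have := M.sum_P_remaining s a
        rw [show (M.H - M.layer s : ℝ) = ∑ u, M.P s a u * (M.H + 1 - M.layer u : ℝ) by linarith,
          Finset.mul_sum]
        exact Finset.sum_congr rfl fun u _ => by ring
      simp only [transOp, this, ← Finset.sum_mul, (π s).2.2, one_mul]
    have := hU s
    have := hc s
    linarith

theorem nonneg_of_recursion {π : Policy S A} {U c : S → ℝ}
    (hU : ∀ s, U s = M.transOp π U s + c s) (hc : ∀ s, 0 ≤ c s) (s : S) : 0 ≤ U s := by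
  induction s using M.layer_induction with
  | h s ih =>
    have h1 := M.transOp_le_transOp π s (g := fun _ => 0) (g' := U) ih
    have h4 : M.transOp π (fun _ => 0) s = 0 := by simp [transOp]
    have := hU s
    have := hc s
    linarith

/-- Change of measure: the solution of `U = P_π U + c` under another policy `ρ`. -/
theorem le_of_recursion_change {π ρ : Policy S A} (hπ : ∀ s a, 0 < (π s).1 a) {U c : S → ℝ}
    {B : ℝ} (hU : ∀ s, U s = M.transOp π U s + c s) (hc : ∀ s, 0 ≤ c s) (hB : 0 < B)
    (hUB : ∀ s, U s ≤ B) :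
    U M.s₁ ≤ 2 * B * ∑ s, M.occ ρ s * klFin (ρ s) (π s) + 2 * ∑ s, M.occ ρ s * c s := by
  have hU0 := M.nonneg_of_recursion hU hc
  set G : S → ℝ := fun s => 1 - U s / (2 * B) with hG
  have hG2 : ∀ s, 1 / 2 ≤ G s := fun s => by
    have : U s / (2 * B) ≤ 1 / 2 := by
      rw [div_le_iff₀ (by linarith)]; linarith [hUB s]
    simp only [hG]; linarith
  have hGpos : ∀ s, 0 < G s := fun s => by linarith [hG2 s]
  have hlog : ∀ x d : ℝ, 1 / 2 ≤ x → 0 ≤ d → Real.log (x + d) ≤ Real.log x + 2 * d := by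
    intro x d hx hd
    have hx0 : 0 < x := by linarith
    have h1 := Real.log_le_sub_one_of_pos (show 0 < (x + d) / x by positivity)
    rw [Real.log_div (by positivity) hx0.ne'] at h1
    have h2 : (x + d) / x - 1 ≤ 2 * d := by
      rw [add_div, div_self hx0.ne', add_sub_cancel_left, div_le_iff₀ hx0]
      nlinarith
    linarith
  have hstep : ∀ s, -Real.log (G s) - M.transOp ρ (fun u => -Real.log (G u)) s ≤
      klFin (ρ s) (π s) + c s / B := by
    intro s
    have hd : 0 ≤ c s / (2 * B) := div_nonneg (hc s) (by linarith)
    have hd2 : 2 * (c s / (2 * B)) = c s / B := by field_simp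
    have hk := klFin_nonneg (ρ s) (π s) (hπ s)
    -- Before the last layer, transitions have mass one and carry the constant 1 in G along. At the
    -- last layer they vanish and U = c, so G + c / (2B) = 1.
    rcases (M.layer_le s).lt_or_eq with hs | hs
    · have hGeq : G s + c s / (2 * B) = ∑ a, (π s).1 a * ∑ u, M.P s a u * G u := by
        have h1 : ∀ a, ∑ u, M.P s a u * G u = 1 - (∑ u, M.P s a u * U u) / (2 * B) := fun a => by
          simp only [hG, mul_sub, Finset.sum_sub_distrib, mul_one, M.P_sum s a hs, ← mul_div_assoc,
            Finset.sum_div]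
        simp only [h1, mul_sub, Finset.sum_sub_distrib, mul_one, (π s).2.2, ← mul_div_assoc,
          ← Finset.sum_div]
        have := hU s
        rw [transOp] at this
        simp only [hG]
        rw [this]
        ring
      have hy : ∀ a, 0 < ∑ u, M.P s a u * G u := fun a => by
        have := M.sum_P_mul_le_sum s a (g := fun _ => 1 / 2) (g' := G) fun u _ => hG2 u
        rw [← Finset.sum_mul, M.P_sum s a hs] at this
        linarith
      have hdv := sum_mul_log_sub_klFin_le (ρ s) (π s) (hπ s) _ hy
      rw [← hGeq] at hdv
      have hjen : ∀ a, ∑ u, M.P s a u * Real.log (G u) ≤ Real.log (∑ u, M.P s a u * G u) := by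
        intro a
        have := strictConcaveOn_log_Ioi.concaveOn.le_map_sum (t := Finset.univ)
          (w := M.P s a) (p := G) (fun u _ => M.P_nonneg s a u) (M.P_sum s a hs)
          fun u _ => hGpos u
        simpa using this
      have hsum : M.transOp ρ (fun u => Real.log (G u)) s ≤
          ∑ a, (ρ s).1 a * Real.log (∑ u, M.P s a u * G u) :=
        Finset.sum_le_sum fun a _ => mul_le_mul_of_nonneg_left (hjen a) ((ρ s).2.1 a)
      have hneg : M.transOp ρ (fun u => -Real.log (G u)) s =
          -M.transOp ρ (fun u => Real.log (G u)) s := by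
        simp only [transOp, mul_neg, Finset.sum_neg_distrib]
      have := hlog (G s) _ (hG2 s) hd
      rw [hneg]
      linarith
    · have h0 : ∀ (σ : Policy S A) (g : S → ℝ), M.transOp σ g s = 0 := fun σ g => by
        simp only [transOp, M.sum_P_of_layer_eq _ hs, mul_zero, Finset.sum_const_zero]
      have h1 : G s + c s / (2 * B) = 1 := by
        simp only [hG]; rw [hU s, h0]; ring
      have := hlog (G s) _ (hG2 s) hd
      rw [h1, Real.log_one] at this
      rw [h0]
      linarith
  have hsum := M.sum_occ_mul_sub_transOp ρ fun u => -Real.log (G u)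
  have hle : -Real.log (G M.s₁) ≤ ∑ s, M.occ ρ s * (klFin (ρ s) (π s) + c s / B) := by
    rw [← hsum]
    exact Finset.sum_le_sum fun s _ => mul_le_mul_of_nonneg_left (hstep s) (M.occ_nonneg ρ s)
  -- The inequality -log (1 - x) ≥ x recovers U from its transform.
  have h1 := Real.log_le_sub_one_of_pos (hGpos M.s₁)
  have h2 : U M.s₁ / (2 * B) ≤ ∑ s, M.occ ρ s * (klFin (ρ s) (π s) + c s / B) := by
    simp only [hG] at h1 hle ⊢
    linarith
  rw [div_le_iff₀ (by linarith)] at h2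
  refine h2.trans_eq ?_
  simp only [mul_add, Finset.sum_add_distrib, mul_div_assoc', ← Finset.sum_div]
  field_simp

/-- Second-order bound of the suboptimality of a greedy policy. -/
theorem sub_J_softmax_le {π : Policy S A} (hπ : M.IsOptimal π) {f : S → A → ℝ}
    (hf : ∀ s a, f s a ∈ Set.Icc (0 : ℝ) M.H) (hQ : ∀ s a, M.qStar s a ∈ Set.Icc (0 : ℝ) M.H) :
    M.J π - M.J (M.softmax f) ≤ (4 * M.H ^ 2 + 4 * M.H + 2 * M.α) *
      ∑ s, M.occ π s * klFin (π s) (M.softmax f s) := by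
  have hH := M.one_le_H_real
  have hrec := M.softValue_sub_value_eq M.bellman_qStar (M.softmax f)
  have hc : ∀ s, 0 ≤ M.α * klFin (M.softmax f s) (M.softmax M.qStar s) := fun s =>
    mul_nonneg M.α_pos.le (klFin_nonneg _ _ (M.softmax_pos _ s))
  -- Each step costs at most 2H and there are at most H steps.
  have hB : ∀ s, M.softValue M.qStar s - M.value (M.softmax f) s ≤ 2 * M.H ^ 2 := fun s => by
    refine (M.le_of_recursion hrec (B := 2 * M.H)
      (M.mul_klFin_softmax_le_range hf hQ) s).trans ?_
    have : (1 : ℝ) ≤ M.layer s := by exact_mod_cast M.one_le_layer s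
    nlinarith
  have h := M.le_of_recursion_change (ρ := π) (M.softmax_pos f) hrec hc (by positivity) hB
  -- An optimal policy is the softmax of Q⋆ only where it visits; elsewhere its occupancy kills the
  -- term.
  have hswap : ∑ s, M.occ π s * (M.α * klFin (M.softmax f s) (M.softmax M.qStar s)) ≤
      (M.α + 2 * M.H) * ∑ s, M.occ π s * klFin (π s) (M.softmax f s) := by
    rw [Finset.mul_sum]
    refine Finset.sum_le_sum fun s _ => ?_
    by_cases hs : M.occ π s = 0
    · simp [hs]
    · rw [hπ.eq_softmax_qStar hs, mul_left_comm (M.α + _)]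
      exact mul_le_mul_of_nonneg_left (M.mul_klFin_softmax_le_swap hf hQ s) (M.occ_nonneg π s)
  rw [hπ.J_eq]
  refine h.trans ?_
  linarith

end KLRegularizedMDP

/-! ### Exponential inequalities -/

section Concentration

/-- Hoeffding's lemma as a bound of an exponential moment by one. -/
theorem lintegral_exp_hoeffding_le_one {Ω : Type*} [MeasurableSpace Ω] (ρ : Measure Ω)
    [IsProbabilityMeasure ρ] {X : Ω → ℝ} (hX : Measurable X) {a b m : ℝ}
    (hb : ∀ᵐ z ∂ρ, X z ∈ Set.Icc a b) (hm : ∫ z, X z ∂ρ = m) (t : ℝ) :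
    ∫⁻ z, ENNReal.ofReal (Real.exp (t * (X z - m) - t ^ 2 * (b - a) ^ 2 / 8)) ∂ρ ≤ 1 := by
  have h := hasSubgaussianMGF_of_mem_Icc hX.aemeasurable hb
  rw [hm] at h
  have h1 := h.mgf_le t
  have h2 := h.integrable_exp_mul t
  simp only [Real.exp_sub]
  rw [← ofReal_integral_eq_lintegral_ofReal (h2.div_const _)
    (Filter.Eventually.of_forall fun z => by positivity), integral_div, ← ENNReal.ofReal_one]
  refine ENNReal.ofReal_le_ofReal ?_
  rw [div_le_one (Real.exp_pos _)]
  refine h1.trans_eq ?_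
  congr 1
  push_cast
  rw [Real.norm_eq_abs, div_pow, sq_abs]
  ring

/-- Chernoff bound and union bound for sums of independent identically distributed variables. -/
theorem exists_measure_le_forall_sum_le {Ω E ι : Type*} [MeasurableSpace Ω] [MeasurableSpace E]
    {Pr : Measure Ω} {ν : Measure E} {n : ℕ} {D : Fin n → Ω → E} (hD : ∀ i, Measurable (D i))
    (hind : iIndepFun D Pr) (hlaw : ∀ i, Pr.map (D i) = ν) (T : Finset ι) {X : ι → E → ℝ}
    (hX : ∀ j ∈ T, Measurable (X j))
    (hexp : ∀ j ∈ T, ∫⁻ z, ENNReal.ofReal (Real.exp (X j z)) ∂ν ≤ 1) (L : ℝ) :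
    ∃ E, Pr E ≤ T.card * ENNReal.ofReal (Real.exp (-L)) ∧
      ∀ ω ∉ E, ∀ j ∈ T, ∑ i, X j (D i ω) ≤ L := by
  have hone : ∀ j ∈ T, Pr {ω | L < ∑ i, X j (D i ω)} ≤ ENNReal.ofReal (Real.exp (-L)) := by
    intro j hj
    have hm : Measurable fun z => ENNReal.ofReal (Real.exp (X j z)) :=
      (Real.measurable_exp.comp (hX j hj)).ennreal_ofReal
    have hprod : ∫⁻ ω, ENNReal.ofReal (Real.exp (∑ i, X j (D i ω))) ∂Pr ≤ 1 := by
      simp only [Real.exp_sum]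
      simp only [ENNReal.ofReal_prod_of_nonneg fun i _ => (Real.exp_pos _).le]
      rw [lintegral_prod_eq_prod_lintegral_of_indepFun Finset.univ
        (fun i ω => ENNReal.ofReal (Real.exp (X j (D i ω))))
        (hind.comp (fun _ z => ENNReal.ofReal (Real.exp (X j z))) fun _ => hm)
        fun i => hm.comp (hD i)]
      refine Finset.prod_le_one' fun i _ => ?_
      rw [← lintegral_map hm (hD i), hlaw i]
      exact hexp j hj
    have hmS : Measurable fun ω => ENNReal.ofReal (Real.exp (∑ i, X j (D i ω))) :=
      (Real.measurable_exp.comp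
        (Finset.measurable_sum _ fun i _ => (hX j hj).comp (hD i))).ennreal_ofReal
    have hmark := mul_meas_ge_le_lintegral (μ := Pr) hmS (ENNReal.ofReal (Real.exp L))
    have hsub : {ω | L < ∑ i, X j (D i ω)} ⊆
        {ω | ENNReal.ofReal (Real.exp L) ≤ ENNReal.ofReal (Real.exp (∑ i, X j (D i ω)))} :=
      fun ω hω => ENNReal.ofReal_le_ofReal (Real.exp_le_exp.2 (le_of_lt hω))
    have h1 : ENNReal.ofReal (Real.exp L) * Pr {ω | L < ∑ i, X j (D i ω)} ≤ 1 :=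
      (mul_le_mul_right (measure_mono hsub) _).trans (hmark.trans hprod)
    have h2 := mul_le_mul_right h1 (ENNReal.ofReal (Real.exp (-L)))
    rwa [← mul_assoc, ← ENNReal.ofReal_mul (Real.exp_pos _).le, ← Real.exp_add, neg_add_cancel,
      Real.exp_zero, ENNReal.ofReal_one, one_mul, mul_one] at h2
  have hU : {ω | ∃ j ∈ T, L < ∑ i, X j (D i ω)} = ⋃ j ∈ T, {ω | L < ∑ i, X j (D i ω)} := by
    ext ω; simp
  refine ⟨{ω | ∃ j ∈ T, L < ∑ i, X j (D i ω)}, ?_,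
    fun ω hω j hj => not_lt.1 fun h => hω ⟨j, hj, h⟩⟩
  rw [hU]
  refine (measure_biUnion_finset_le T _).trans ((Finset.sum_le_sum hone).trans_eq ?_)
  rw [Finset.sum_const, nsmul_eq_mul]

end Concentration

namespace KLRegularizedMDP

/-! ### Observations -/

section Observations

variable {S A : Type*} [MeasurableSpace S] [MeasurableSpace A]

/-- Observations with a given state and action. -/
def cell (s : S) (a : A) : Set (Observation S A) := {z | z.1 = s ∧ z.2.1 = a}

theorem measurableSet_cell [MeasurableSingletonClass S] [MeasurableSingletonClass A] (s : S)
    (a : A) : MeasurableSet (cell s a) :=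
  (measurable_fst (measurableSet_singleton s)).inter
    ((measurable_fst.comp measurable_snd) (measurableSet_singleton a))

theorem measurable_stateAction [Finite S] [Finite A] [MeasurableSingletonClass S]
    [MeasurableSingletonClass A] {β : Type*} [MeasurableSpace β] (g : S → A → β) :
    Measurable fun z : Observation S A => g z.1 z.2.1 :=
  (Measurable.of_discrete (f := fun p : S × A => g p.1 p.2)).comp
    (measurable_fst.prodMk (measurable_fst.comp measurable_snd))

theorem measurable_nextState {β : Type*} [MeasurableSpace β] (g : Option S → β) :
    Measurable fun z : Observation S A => g z.2.2.2 :=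
  (measurable_from_top (f := g)).comp
    (measurable_snd.comp (measurable_snd.comp measurable_snd))

theorem measurable_reward : Measurable fun z : Observation S A => z.2.2.1 :=
  measurable_fst.comp (measurable_snd.comp measurable_snd)

theorem sum_sum_eq_one {S A : Type*} [Fintype S] [Fintype A] (μ : stdSimplex ℝ (S × A)) :
    ∑ s, ∑ a, μ.1 (s, a) = 1 := by
  rw [← Fintype.sum_prod_type' (f := fun s a => μ.1 (s, a))]
  exact μ.2.2

end Observations

variable {S A : Type*} [Fintype S] [Fintype A] (M : KLRegularizedMDP S A)

/-! ### The law of one observation -/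

section SamplingLaw

variable [MeasurableSpace S] [MeasurableSingletonClass S]
  [MeasurableSpace A] [MeasurableSingletonClass A]

theorem lintegral_eq_sum_cell (ν : Measure (Observation S A)) (g : Observation S A → ENNReal) :
    ∫⁻ z, g z ∂ν = ∑ s, ∑ a, ∫⁻ z in cell s a, g z ∂ν := by
  rw [← Fintype.sum_prod_type' (f := fun s a => ∫⁻ z in cell s a, g z ∂ν), ← setLIntegral_univ g]
  have hU : (Set.univ : Set (Observation S A)) =
      ⋃ p ∈ (Finset.univ : Finset (S × A)), cell p.1 p.2 := by
    ext z; simp [cell]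
  rw [hU, lintegral_biUnion_finset]
  · rintro p - q - hpq
    refine Set.disjoint_left.2 fun z hz hz' => hpq ?_
    exact Prod.ext (hz.1.symm.trans hz'.1) (hz.2.symm.trans hz'.2)
  · exact fun p _ => measurableSet_cell p.1 p.2

variable {M} {μ : stdSimplex ℝ (S × A)} {ν : Measure (Observation S A)}

theorem IsSamplingLaw.lintegral_stateAction (hν : M.IsSamplingLaw μ ν) {g : S → A → ℝ}
    (hg : ∀ s a, 0 ≤ g s a) :
    ∫⁻ z, ENNReal.ofReal (g z.1 z.2.1) ∂ν = ENNReal.ofReal (∑ s, ∑ a, μ.1 (s, a) * g s a) := by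
  rw [lintegral_eq_sum_cell, ENNReal.ofReal_sum_of_nonneg fun s _ =>
    Finset.sum_nonneg fun a _ => mul_nonneg (μ.2.1 _) (hg s a)]
  refine Finset.sum_congr rfl fun s _ => ?_
  rw [ENNReal.ofReal_sum_of_nonneg fun a _ => mul_nonneg (μ.2.1 _) (hg s a)]
  refine Finset.sum_congr rfl fun a _ => ?_
  rw [setLIntegral_congr_fun (g := fun _ => ENNReal.ofReal (g s a)) (measurableSet_cell s a)
    fun z hz => by simp only [hz.1, hz.2], setLIntegral_const, ENNReal.ofReal_mul (μ.2.1 _),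
    mul_comm]
  congr 1
  exact hν.state_action s a

theorem IsSamplingLaw.isProbabilityMeasure (hν : M.IsSamplingLaw μ ν) :
    IsProbabilityMeasure ν := by
  refine ⟨?_⟩
  have := hν.lintegral_stateAction (g := fun _ _ => 1) fun _ _ => zero_le_one
  simpa [sum_sum_eq_one] using this

/-- Lower tail of nonnegative functions of the state and the action. -/
theorem IsSamplingLaw.lintegral_exp_lower_tail_le_one (hν : M.IsSamplingLaw μ ν) {g : S → A → ℝ}
    {b : ℝ} (hb : 0 < b) (hg : ∀ s a, g s a ∈ Set.Icc 0 b) :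
    ∫⁻ z, ENNReal.ofReal (Real.exp
      ((∑ s, ∑ a, μ.1 (s, a) * g s a) / (2 * b) - g z.1 z.2.1 / b)) ∂ν ≤ 1 := by
  set m := ∑ s, ∑ a, μ.1 (s, a) * g s a with hm
  rw [hν.lintegral_stateAction (g := fun s a => Real.exp (m / (2 * b) - g s a / b))
    fun _ _ => (Real.exp_pos _).le, ← ENNReal.ofReal_one]
  refine ENNReal.ofReal_le_ofReal ?_
  -- Replacing the exponential by this chord-type bound costs half of the mean, which is why the
  -- exponent has m / (2b) rather than m / b.
  have hpt : ∀ x ∈ Set.Icc (0 : ℝ) 1, Real.exp (-x) ≤ 1 - x / 2 := fun x hx => by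
    have h1 := Real.quadratic_le_exp_of_nonneg hx.1
    have h2 : Real.exp (-x) * Real.exp x = 1 := by rw [← Real.exp_add]; simp
    have h3 := Real.exp_pos (-x)
    have h4 : 1 ≤ (1 - x / 2) * Real.exp x := by
      nlinarith [hx.1, hx.2, mul_nonneg hx.1 (sub_nonneg.2 hx.2),
        mul_le_mul_of_nonneg_left h1 (show 0 ≤ 1 - x / 2 by linarith [hx.2]),
        mul_nonneg (mul_nonneg hx.1 hx.1) (sub_nonneg.2 hx.2), mul_nonneg hx.1 hx.1]
    nlinarith
  calc ∑ s, ∑ a, μ.1 (s, a) * Real.exp (m / (2 * b) - g s a / b)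
      ≤ ∑ s, ∑ a, μ.1 (s, a) * (Real.exp (m / (2 * b)) * (1 - g s a / b / 2)) := by
        refine Finset.sum_le_sum fun s _ => Finset.sum_le_sum fun a _ =>
          mul_le_mul_of_nonneg_left ?_ (μ.2.1 _)
        rw [sub_eq_add_neg, Real.exp_add]
        refine mul_le_mul_of_nonneg_left (hpt _ ?_) (Real.exp_pos _).le
        exact ⟨div_nonneg (hg s a).1 hb.le, (div_le_one hb).2 (hg s a).2⟩
    _ = Real.exp (m / (2 * b)) * (1 - m / (2 * b)) := by
        have h1 : ∑ s, ∑ a, μ.1 (s, a) * (1 - g s a / b / 2) = 1 - m / (2 * b) := by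
          simp only [mul_sub, Finset.sum_sub_distrib, mul_one, sum_sum_eq_one, ← mul_div_assoc,
            ← Finset.sum_div]
          rw [← hm, div_div, mul_comm b]
        simp only [← h1, Finset.mul_sum]
        exact Finset.sum_congr rfl fun s _ => Finset.sum_congr rfl fun a _ => by ring
    _ ≤ Real.exp (m / (2 * b)) * Real.exp (-(m / (2 * b))) := by
        refine mul_le_mul_of_nonneg_left ?_ (Real.exp_pos _).le
        linarith [Real.add_one_le_exp (-(m / (2 * b)))]
    _ = 1 := by rw [← Real.exp_add]; simp

theorem IsSamplingLaw.integral_stateAction (hν : M.IsSamplingLaw μ ν) (g : S → A → ℝ) :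
    ∫ z, g z.1 z.2.1 ∂ν = ∑ s, ∑ a, μ.1 (s, a) * g s a := by
  have := hν.isProbabilityMeasure
  have hpt : ∀ z : Observation S A,
      g z.1 z.2.1 = ∑ p : S × A, (cell p.1 p.2).indicator (fun _ => g p.1 p.2) z := fun z => by
    classical
    rw [Finset.sum_eq_single (z.1, z.2.1)]
    · simp [cell]
    · intro p _ hp
      refine Set.indicator_of_notMem (fun h => hp (Prod.ext h.1.symm h.2.symm)) _
    · simp
  simp_rw [hpt]
  rw [integral_finsetSum _ fun p _ =>
    (integrable_const _).indicator (measurableSet_cell p.1 p.2), ← Fintype.sum_prod_type']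
  refine Finset.sum_congr rfl fun p _ => ?_
  rw [integral_indicator_const _ (measurableSet_cell p.1 p.2), Measure.real, cell,
    hν.state_action, ENNReal.toReal_ofReal (μ.2.1 _), smul_eq_mul]

/-- The regression target `r + f(s')`. -/
theorem IsSamplingLaw.setIntegral_target (hν : M.IsSamplingLaw μ ν) (f : S → A → ℝ) (s : S)
    (a : A) : ∫ z in cell s a, (z.2.2.1 + M.nextValue f z.2.2.2) ∂ν =
      μ.1 (s, a) * M.bellman f s a := by
  have := hν.isProbabilityMeasure
  have hset : ∀ u : S, MeasurableSet {z : Observation S A | z.2.2.2 = some u} := fun u =>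
    (measurable_nextState (A := A) id) (show MeasurableSet {some u} from trivial)
  have hnext : ∀ z : Observation S A, M.nextValue f z.2.2.2 =
      ∑ u, {z : Observation S A | z.2.2.2 = some u}.indicator (fun _ => M.softValue f u) z := by
    classical
    intro z
    rcases h : z.2.2.2 with _ | v
    · simp [nextValue, Set.indicator, h]
    · simp [nextValue, Set.indicator, h]
  have hr : Integrable (fun z : Observation S A => z.2.2.1) ν :=
    Integrable.of_mem_Icc 0 1 measurable_reward.aemeasurable hν.reward_mem
  have hi : ∀ u, Integrable ({z : Observation S A | z.2.2.2 = some u}.indicator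
      fun _ => M.softValue f u) (ν.restrict (cell s a)) := fun u =>
    (integrable_const _).indicator (hset u)
  simp_rw [hnext]
  rw [integral_add hr.integrableOn (integrable_finsetSum _ fun u _ => hi u),
    integral_finsetSum _ fun u _ => hi u, bellman, mul_add, Finset.mul_sum]
  congr 1
  · exact hν.reward_mean s a
  · refine Finset.sum_congr rfl fun u _ => ?_
    rw [integral_indicator_const _ (hset u), Measure.real, Measure.restrict_apply (hset u)]
    have : {z : Observation S A | z.2.2.2 = some u} ∩ cell s a =
        {z | z.1 = s ∧ z.2.1 = a ∧ z.2.2.2 = some u} := by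
      ext z; simp only [cell, Set.mem_inter_iff, Set.mem_ofPred_eq]; tauto
    rw [this, hν.next_state, ENNReal.toReal_ofReal (mul_nonneg (μ.2.1 _) (M.P_nonneg _ _ _)),
      smul_eq_mul, mul_assoc]

/-- Self-normalized exponential inequality for the regression noise. -/
theorem IsSamplingLaw.lintegral_exp_regression_le_one (hν : M.IsSamplingLaw μ ν)
    {f : S → A → ℝ} {B : ℝ} (hf : ∀ s a, f s a ∈ Set.Icc 0 B) (u : S → A → ℝ)
    (t : ℝ) :
    ∫⁻ z, ENNReal.ofReal (Real.exp (t * u z.1 z.2.1 *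
      (z.2.2.1 + M.nextValue f z.2.2.2 - M.bellman f z.1 z.2.1) -
        (t * u z.1 z.2.1) ^ 2 * (B + 1) ^ 2 / 8)) ∂ν ≤ 1 := by
  have hp := hν.isProbabilityMeasure
  have hB : 0 ≤ B := by
    obtain ⟨a, _⟩ := univ_nonempty_of_stdSimplex (M.πref M.s₁)
    exact (hf M.s₁ a).1.trans (hf M.s₁ a).2
  have hY : Measurable fun z : Observation S A => z.2.2.1 + M.nextValue f z.2.2.2 :=
    measurable_reward.add (measurable_nextState _)
  have hYmem : ∀ᵐ z ∂ν, z.2.2.1 + M.nextValue f z.2.2.2 ∈ Set.Icc 0 (B + 1) := by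
    filter_upwards [hν.reward_mem] with z hz
    have : M.nextValue f z.2.2.2 ∈ Set.Icc 0 B := by
      rcases z.2.2.2 with _ | v
      · exact ⟨le_rfl, hB⟩
      · exact M.softValue_mem_Icc (hf v)
    exact ⟨add_nonneg hz.1 this.1, by linarith [hz.2, this.2]⟩
  rw [lintegral_eq_sum_cell]
  have hcell : ∀ s a, ∫⁻ z in cell s a, ENNReal.ofReal (Real.exp (t * u z.1 z.2.1 *
      (z.2.2.1 + M.nextValue f z.2.2.2 - M.bellman f z.1 z.2.1) -
        (t * u z.1 z.2.1) ^ 2 * (B + 1) ^ 2 / 8)) ∂ν ≤ ENNReal.ofReal (μ.1 (s, a)) := by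
    intro s a
    have hνc : ν (cell s a) = ENNReal.ofReal (μ.1 (s, a)) := hν.state_action s a
    -- On a cell of positive mass, u is constant and the conditional mean of the target is the
    -- Bellman update, so Hoeffding's lemma applies with parameter t u(s, a).
    rcases (μ.2.1 (s, a)).eq_or_lt with h0 | h0
    · rw [setLIntegral_measure_zero _ _ (by rw [hνc, ← h0]; simp)]
      exact zero_le
    · have hne : ν (cell s a) ≠ 0 := by rw [hνc]; simpa using h0
      have hpc := cond_isProbabilityMeasure hne
      rw [setLIntegral_congr_fun (g := fun z => ENNReal.ofReal (Real.exp (t * u s a *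
        (z.2.2.1 + M.nextValue f z.2.2.2 - M.bellman f s a) -
          (t * u s a) ^ 2 * (B + 1 - 0) ^ 2 / 8))) (measurableSet_cell s a)
        fun z hz => by simp only [hz.1, hz.2, sub_zero]]
      have hmean : ∫ z, (z.2.2.1 + M.nextValue f z.2.2.2) ∂(ν[|cell s a]) = M.bellman f s a := by
        rw [ProbabilityTheory.cond, integral_smul_measure, hν.setIntegral_target, hνc, ENNReal.toReal_inv,
          ENNReal.toReal_ofReal h0.le, smul_eq_mul, inv_mul_cancel_left₀ h0.ne']
      have h := lintegral_exp_hoeffding_le_one (ν[|cell s a]) hY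
        (cond_absolutelyContinuous.ae_le hYmem) hmean (t * u s a)
      rw [ProbabilityTheory.cond, lintegral_smul_measure, smul_eq_mul] at h
      have h2 := mul_le_mul_right h (ν (cell s a))
      rwa [← mul_assoc, ENNReal.mul_inv_cancel hne (measure_ne_top _ _), one_mul, mul_one,
        hνc] at h2
  refine (Finset.sum_le_sum fun s _ => Finset.sum_le_sum fun a _ => hcell s a).trans_eq ?_
  rw [← ENNReal.ofReal_one, ← sum_sum_eq_one μ, ENNReal.ofReal_sum_of_nonneg fun s _ =>
    Finset.sum_nonneg fun a _ => μ.2.1 _]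
  exact Finset.sum_congr rfl fun s _ => (ENNReal.ofReal_sum_of_nonneg fun a _ => μ.2.1 _).symm

end SamplingLaw

end KLRegularizedMDP

namespace KLRegularizedMDP

variable {S A : Type*} [Fintype S] [Fintype A] (M : KLRegularizedMDP S A)

/-! ### Concentration on the data set -/

/-- Mean of a function of the state and the action under the data distribution. -/
def dataMean (μ : stdSimplex ℝ (S × A)) (g : S → A → ℝ) : ℝ := ∑ s, ∑ a, μ.1 (s, a) * g s a

/-- Difference of the pessimism terms of `f` and of `Q⋆`. -/
def pessimismGap (f : S → A → ℝ) (s : S) (a : A) : ℝ :=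
  (M.softValue f s - f s a) - (M.softValue M.qStar s - M.qStar s a)

theorem pessimismGap_mem_Icc {f : S → A → ℝ} {B : ℝ} (hf : ∀ s a, f s a ∈ Set.Icc 0 B)
    (hQ : ∀ s a, M.qStar s a ∈ Set.Icc 0 B) (s : S) (a : A) :
    M.pessimismGap f s a ∈ Set.Icc (-(2 * B)) (2 * B) := by
  have h1 := hf s a
  have h2 := hQ s a
  have h3 := M.softValue_mem_Icc (hf s)
  have h4 := M.softValue_mem_Icc (hQ s)
  simp only [Set.mem_Icc] at *
  constructor <;> simp only [pessimismGap] <;> linarith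

theorem bellman_mem_Icc {f : S → A → ℝ} {B : ℝ} (hf : ∀ s a, f s a ∈ Set.Icc 0 B) (s : S)
    (a : A) : M.bellman f s a ∈ Set.Icc 0 (B + 1) := by
  have hv : ∀ u, M.softValue f u ∈ Set.Icc 0 B := fun u => M.softValue_mem_Icc (hf u)
  have h1 := M.sum_P_mul_nonneg s a fun u => (hv u).1
  have h2 := M.sum_P_mul_le s a ((hf s a).1.trans (hf s a).2) fun u => (hv u).2
  have h3 := M.R_mem s a
  exact ⟨add_nonneg h3.1 h1, by rw [bellman]; linarith [h3.2]⟩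

theorem sq_bellmanError_mem_Icc {f : S → A → ℝ} {B : ℝ} (hf : ∀ s a, f s a ∈ Set.Icc 0 B) (s : S)
    (a : A) : (f s a - M.bellman f s a) ^ 2 ∈ Set.Icc 0 ((B + 1) ^ 2) := by
  have h1 := M.bellman_mem_Icc hf s a
  have h2 := hf s a
  exact ⟨sq_nonneg _, sq_le_sq' (by linarith [h1.2, h2.1]) (by linarith [h1.1, h2.2])⟩

/-- The deviations that the analysis of CQL has to control are at most `L`. -/
structure Concentrated {n : ℕ} (F G : Finset (S → A → ℝ)) (μ : stdSimplex ℝ (S × A)) (lam L : ℝ)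
    (D : Fin n → Observation S A) : Prop where
  regression : ∀ f ∈ F, ∀ g ∈ G,
    ∑ i, (2 / (M.H + 1 : ℝ) ^ 2 * (g (D i).1 (D i).2.1 - M.bellman f (D i).1 (D i).2.1) *
      ((D i).2.2.1 + M.nextValue f (D i).2.2.2 - M.bellman f (D i).1 (D i).2.1) -
        (2 / (M.H + 1 : ℝ) ^ 2 * (g (D i).1 (D i).2.1 - M.bellman f (D i).1 (D i).2.1)) ^ 2 *
          (M.H + 1 : ℝ) ^ 2 / 8) ≤ L
  bellmanError : ∀ f ∈ F,
    ∑ i, (dataMean μ (fun s a => (f s a - M.bellman f s a) ^ 2) / (2 * (M.H + 1 : ℝ) ^ 2) -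
      (f (D i).1 (D i).2.1 - M.bellman f (D i).1 (D i).2.1) ^ 2 / (M.H + 1 : ℝ) ^ 2) ≤ L
  pessimism : ∀ f ∈ F,
    ∑ i, (-(1 / (lam * (M.H : ℝ) ^ 2)) *
      (M.pessimismGap f (D i).1 (D i).2.1 - dataMean μ (M.pessimismGap f)) -
        (-(1 / (lam * (M.H : ℝ) ^ 2))) ^ 2 * (2 * M.H - -(2 * M.H : ℝ)) ^ 2 / 8) ≤ L

/-- All variables in the three families are indexed by fixed functions. The union bound therefore
covers the data-dependent minimizers, however ties are broken. -/
theorem measure_concentrated_ge {Ω : Type*} [MeasurableSpace S] [MeasurableSingletonClass S]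
    [MeasurableSpace A] [MeasurableSingletonClass A] [MeasurableSpace Ω] {Pr : Measure Ω}
    [IsProbabilityMeasure Pr] {F G : Finset (S → A → ℝ)}
    (hF : ∀ f ∈ F, ∀ s a, f s a ∈ Set.Icc (0 : ℝ) M.H) (hQ : M.qStar ∈ F) (hG : G.Nonempty)
    {μ : stdSimplex ℝ (S × A)} {n : ℕ} {ν : Measure (Observation S A)} (hν : M.IsSamplingLaw μ ν)
    {D : Fin n → Ω → Observation S A} (hD : ∀ i, Measurable (D i)) (hind : iIndepFun D Pr)
    (hlaw : ∀ i, Pr.map (D i) = ν) (lam : ℝ) {δ : ℝ} (hδ : 0 < δ) :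
    ENNReal.ofReal (1 - δ) ≤ Pr {ω | M.Concentrated F G μ lam
      (Real.log (3 * ((F.card : ℝ) * G.card) / δ)) fun i => D i ω} := by
  have hνp := hν.isProbabilityMeasure
  set L := Real.log (3 * ((F.card : ℝ) * G.card) / δ) with hL
  have hFc : (1 : ℝ) ≤ F.card := by exact_mod_cast Finset.card_pos.2 ⟨_, hQ⟩
  have hGc : (1 : ℝ) ≤ G.card := by exact_mod_cast Finset.card_pos.2 hG
  obtain ⟨E1, h1, hE1⟩ := exists_measure_le_forall_sum_le hD hind hlaw (F ×ˢ G)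
    (X := fun p z => 2 / (M.H + 1 : ℝ) ^ 2 * (p.2 z.1 z.2.1 - M.bellman p.1 z.1 z.2.1) *
      (z.2.2.1 + M.nextValue p.1 z.2.2.2 - M.bellman p.1 z.1 z.2.1) -
        (2 / (M.H + 1 : ℝ) ^ 2 * (p.2 z.1 z.2.1 - M.bellman p.1 z.1 z.2.1)) ^ 2 *
          (M.H + 1 : ℝ) ^ 2 / 8)
    (fun p _ => by
      have m1 := measurable_stateAction fun s a => p.2 s a - M.bellman p.1 s a
      have m2 := measurable_stateAction fun s a => M.bellman p.1 s a
      have m3 := measurable_nextState (A := A) (M.nextValue p.1)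
      have m4 := measurable_reward (S := S) (A := A)
      exact ((m1.const_mul _).mul ((m4.add m3).sub m2)).sub
        ((((m1.const_mul _).pow_const 2).mul_const _).div_const _))
    (fun p hp => hν.lintegral_exp_regression_le_one (hF p.1 (Finset.mem_product.1 hp).1)
      (fun s a => p.2 s a - M.bellman p.1 s a) _) L
  obtain ⟨E2, h2, hE2⟩ := exists_measure_le_forall_sum_le hD hind hlaw F
    (X := fun f z => dataMean μ (fun s a => (f s a - M.bellman f s a) ^ 2) /
      (2 * (M.H + 1 : ℝ) ^ 2) - (f z.1 z.2.1 - M.bellman f z.1 z.2.1) ^ 2 / (M.H + 1 : ℝ) ^ 2)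
    (fun f _ => ((measurable_stateAction fun s a =>
      (f s a - M.bellman f s a) ^ 2).div_const _).const_sub _)
    (fun f hf => hν.lintegral_exp_lower_tail_le_one (by positivity)
      (M.sq_bellmanError_mem_Icc (hF f hf))) L
  obtain ⟨E3, h3, hE3⟩ := exists_measure_le_forall_sum_le hD hind hlaw F
    (X := fun f z => -(1 / (lam * (M.H : ℝ) ^ 2)) *
      (M.pessimismGap f z.1 z.2.1 - dataMean μ (M.pessimismGap f)) -
        (-(1 / (lam * (M.H : ℝ) ^ 2))) ^ 2 * (2 * M.H - -(2 * M.H : ℝ)) ^ 2 / 8)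
    (fun f _ => (((measurable_stateAction (M.pessimismGap f)).sub_const _).const_mul _).sub_const _)
    (fun f hf => lintegral_exp_hoeffding_le_one ν (measurable_stateAction (M.pessimismGap f))
      (Filter.Eventually.of_forall fun z => M.pessimismGap_mem_Icc (hF f hf) (hF _ hQ) _ _)
      (hν.integral_stateAction _) _) L
  have hbad : Pr (E1 ∪ E2 ∪ E3) ≤ ENNReal.ofReal δ := by
    refine (measure_union_le _ _).trans ((add_le_add ((measure_union_le _ _).trans
      (add_le_add h1 h2)) h3).trans ?_)
    rw [← add_mul, ← add_mul, hL, Real.exp_neg, Real.exp_log (by positivity)]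
    -- The three families have |F||G| + |F| + |F| ≤ 3|F||G| members, hence the 3 in the logarithm.
    have hc : ((F ×ˢ G).card + F.card + F.card : ENNReal) =
        ENNReal.ofReal ((F.card : ℝ) * G.card + F.card + F.card) := by
      rw [Finset.card_product]
      rw [show ((F.card : ℝ) * G.card + F.card + F.card) =
        ((F.card * G.card + F.card + F.card : ℕ) : ℝ) by push_cast; ring, ENNReal.ofReal_natCast]
      push_cast
      ring
    rw [hc, ← ENNReal.ofReal_mul (by positivity)]
    refine ENNReal.ofReal_le_ofReal ?_
    rw [inv_div, mul_div_assoc', div_le_iff₀ (by positivity)]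
    nlinarith [mul_le_mul_of_nonneg_left hGc (show (0 : ℝ) ≤ F.card by linarith)]
  have hsub : (E1 ∪ E2 ∪ E3)ᶜ ⊆ {ω | M.Concentrated F G μ lam L fun i => D i ω} := by
    intro ω hω
    simp only [Set.compl_union, Set.mem_inter_iff, Set.mem_compl_iff] at hω
    exact ⟨fun f hf g hg => hE1 ω hω.1.1 (f, g) (Finset.mem_product.2 ⟨hf, hg⟩),
      hE2 ω hω.1.2, hE3 ω hω.2⟩
  -- Subadditivity replaces the complement rule, so no event has to be measurable.
  have huniv : 1 ≤ Pr (E1 ∪ E2 ∪ E3) + Pr (E1 ∪ E2 ∪ E3)ᶜ := by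
    rw [← measure_univ (μ := Pr), ← Set.union_compl_self (E1 ∪ E2 ∪ E3)]
    exact measure_union_le _ _
  rw [ENNReal.ofReal_sub _ hδ.le, ENNReal.ofReal_one, tsub_le_iff_left]
  exact huniv.trans (add_le_add hbad (measure_mono hsub))

/-! ### Deterministic analysis of CQL -/

variable {M} {n : ℕ} {F G : Finset (S → A → ℝ)} {μ : stdSimplex ℝ (S × A)} {lam L : ℝ}
  {D : Fin n → Observation S A}

/-- By completeness Tf competes in the regression, so the excess loss of `That f` is nonpositive.
That excess is the squared distance to Tf minus twice a noise term, and the self-normalized bound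
lets half of the square absorb the noise. -/
theorem Concentrated.sum_sq_regression_le (h : M.Concentrated F G μ lam L D) (hn : 1 ≤ n)
    (hFG : ∀ f ∈ F, M.bellman f ∈ G)
    {That : (S → A → ℝ) → (S → A → ℝ)} (hT : M.IsRegression F G D That) {f : S → A → ℝ}
    (hf : f ∈ F) :
    ∑ i, (That f (D i).1 (D i).2.1 - M.bellman f (D i).1 (D i).2.1) ^ 2 ≤
      2 * (M.H + 1 : ℝ) ^ 2 * L := by
  have hb : (0 : ℝ) < (M.H + 1 : ℝ) ^ 2 := by positivity
  have h1 := (hT f hf).2 _ (hFG f hf)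
  have h2 := h.regression f hf _ (hT f hf).1
  have hn0 : (0 : ℝ) < 1 / n := by
    have : (0 : ℝ) < n := by exact_mod_cast hn
    positivity
  rw [regressionLoss, regressionLoss, mul_le_mul_iff_right₀ hn0, ← sub_nonneg,
    ← Finset.sum_sub_distrib] at h1
  set b := (M.H + 1 : ℝ) ^ 2
  -- The parameter 2 / b makes the Hoeffding penalty u² / (2b), half of the u² / b in the excess
  -- loss divided by b, where u = That f - Tf.
  have h3 : ∑ i, (2 / b * (That f (D i).1 (D i).2.1 - M.bellman f (D i).1 (D i).2.1) *
      ((D i).2.2.1 + M.nextValue f (D i).2.2.2 - M.bellman f (D i).1 (D i).2.1) -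
        (2 / b * (That f (D i).1 (D i).2.1 - M.bellman f (D i).1 (D i).2.1)) ^ 2 * b / 8) =
      1 / b * ∑ i, ((M.bellman f (D i).1 (D i).2.1 - (D i).2.2.1 - M.nextValue f (D i).2.2.2) ^ 2 -
        (That f (D i).1 (D i).2.1 - (D i).2.2.1 - M.nextValue f (D i).2.2.2) ^ 2) +
      1 / (2 * b) * ∑ i, (That f (D i).1 (D i).2.1 - M.bellman f (D i).1 (D i).2.1) ^ 2 := by
    rw [Finset.mul_sum, Finset.mul_sum, ← Finset.sum_add_distrib]
    refine Finset.sum_congr rfl fun i _ => ?_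
    field_simp
    ring
  rw [h3] at h2
  have h4 : 1 / (2 * b) * ∑ i, (That f (D i).1 (D i).2.1 - M.bellman f (D i).1 (D i).2.1) ^ 2 ≤
      L := by
    have := mul_nonneg (one_div_pos.2 hb).le h1
    linarith
  rw [one_div_mul_eq_div, div_le_iff₀ (by positivity)] at h4
  linarith

/-- The basic inequality of CQL, transferred to the data distribution. -/
theorem Concentrated.dataMean_le (h : M.Concentrated F G μ lam L D) (hn : 1 ≤ n)
    (hlam : 0 < lam) (hL : 0 ≤ L) (hQ : M.qStar ∈ F) (hFG : ∀ f ∈ F, M.bellman f ∈ G)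
    {f : S → A → ℝ} (hf : M.IsCQL F G lam D f) :
    dataMean μ (M.pessimismGap f) +
        lam / 4 * dataMean μ (fun s a => (f s a - M.bellman f s a) ^ 2) ≤
      19 * lam * M.H ^ 2 * L / n + 2 / lam := by
  obtain ⟨That, hT, hfF, hmin⟩ := hf
  have hH := M.one_le_H_real
  have hn0 : (0 : ℝ) < n := by exact_mod_cast hn
  have hb : (0 : ℝ) < (M.H + 1 : ℝ) ^ 2 := by positivity
  have hreg := h.sum_sq_regression_le hn hFG hT hfF
  have hregQ := h.sum_sq_regression_le hn hFG hT hQ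
  rw [M.bellman_qStar] at hregQ
  have hbe := h.bellmanError f hfF
  have hpe := h.pessimism f hfF
  have hm := hmin _ hQ
  set b := (M.H + 1 : ℝ) ^ 2
  set m := dataMean μ (M.pessimismGap f)
  set v := dataMean μ (fun s a => (f s a - M.bellman f s a) ^ 2)
  rw [Finset.sum_sub_distrib, Finset.sum_const, Finset.card_univ, Fintype.card_fin, nsmul_eq_mul,
    ← Finset.sum_div] at hbe
  rw [Finset.sum_sub_distrib, Finset.sum_const, Finset.card_univ, Fintype.card_fin, nsmul_eq_mul,
    ← Finset.mul_sum, Finset.sum_sub_distrib, Finset.sum_const, Finset.card_univ,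
    Fintype.card_fin, nsmul_eq_mul] at hpe
  -- Here Q⋆ is the competitor; since Q⋆ = T Q⋆, its penalty is a pure regression error.
  have hm' : ∑ i, M.pessimismGap f (D i).1 (D i).2.1 +
      lam * ∑ i, (f (D i).1 (D i).2.1 - That f (D i).1 (D i).2.1) ^ 2 ≤
      lam * ∑ i, (That M.qStar (D i).1 (D i).2.1 - M.qStar (D i).1 (D i).2.1) ^ 2 := by
    rw [cqlLoss, cqlLoss, mul_left_comm, mul_left_comm lam, ← mul_add, ← mul_add,
      mul_le_mul_iff_right₀ (by positivity)] at hm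
    have e1 : ∑ i, (M.qStar (D i).1 (D i).2.1 - That M.qStar (D i).1 (D i).2.1) ^ 2 =
        ∑ i, (That M.qStar (D i).1 (D i).2.1 - M.qStar (D i).1 (D i).2.1) ^ 2 :=
      Finset.sum_congr rfl fun i _ => by ring
    simp only [pessimismGap]
    rw [Finset.sum_sub_distrib]
    rw [e1] at hm
    linarith
  have hhalf : 1 / 2 * ∑ i, (f (D i).1 (D i).2.1 - M.bellman f (D i).1 (D i).2.1) ^ 2 -
      ∑ i, (That f (D i).1 (D i).2.1 - M.bellman f (D i).1 (D i).2.1) ^ 2 ≤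
      ∑ i, (f (D i).1 (D i).2.1 - That f (D i).1 (D i).2.1) ^ 2 := by
    rw [Finset.mul_sum, ← Finset.sum_sub_distrib]
    refine Finset.sum_le_sum fun i _ => ?_
    nlinarith [sq_nonneg (f (D i).1 (D i).2.1 - That f (D i).1 (D i).2.1 -
      (That f (D i).1 (D i).2.1 - M.bellman f (D i).1 (D i).2.1))]
  set Z := ∑ i, M.pessimismGap f (D i).1 (D i).2.1
  set E := ∑ i, (f (D i).1 (D i).2.1 - M.bellman f (D i).1 (D i).2.1) ^ 2
  have hbe' : n * v / 2 - E ≤ b * L := by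
    have := mul_le_mul_of_nonneg_left hbe hb.le
    have e : b * (n * (v / (2 * b)) - E / b) = n * v / 2 - E := by field_simp
    linarith
  -- The gap has range 4H, so the parameter 1 / (λ H²) yields a variance term 2 / λ per sample and a
  -- deviation of the same form λ H² L as the regression error.
  have hpe' : n * m - Z ≤ lam * M.H ^ 2 * L + 2 * n / lam := by
    have hc : 0 ≤ lam * (M.H : ℝ) ^ 2 := by positivity
    have := mul_le_mul_of_nonneg_left hpe hc
    have e : lam * (M.H : ℝ) ^ 2 * (-(1 / (lam * (M.H : ℝ) ^ 2)) * (Z - n * m) -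
        n * ((-(1 / (lam * (M.H : ℝ) ^ 2))) ^ 2 * (2 * M.H - -(2 * M.H : ℝ)) ^ 2 / 8)) =
        n * m - Z - 2 * n / lam := by
      field_simp
      ring
    linarith
  have hbH : b ≤ 4 * M.H ^ 2 := by
    simp only [b]; nlinarith
  have h1 := mul_le_mul_of_nonneg_left hregQ hlam.le
  have h2 := mul_le_mul_of_nonneg_left hreg hlam.le
  have h3 := mul_le_mul_of_nonneg_left hhalf hlam.le
  have h4 := mul_le_mul_of_nonneg_left hbe' hlam.le
  have h5 := mul_le_mul_of_nonneg_left hbH (mul_nonneg hlam.le hL)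
  -- The two regressions cost 2b each and the Bellman error b / 2; with b ≤ 4H² and the pessimism
  -- deviation H², the total is 18 + 1 = 19.
  have key : n * (m + lam / 4 * v) ≤ 19 * lam * M.H ^ 2 * L + 2 * n / lam := by nlinarith
  have e : 19 * lam * M.H ^ 2 * L / n + 2 / lam =
      (19 * lam * M.H ^ 2 * L + 2 * n / lam) / n := by field_simp
  rw [e, le_div_iff₀ hn0]
  linarith


end KLRegularizedMDP

/-! ### Transfer to the optimal policy and the regret bound -/

namespace KLRegularizedMDP

variable {S A : Type*} [Fintype S] [Fintype A] {M : KLRegularizedMDP S A}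
  {μ : stdSimplex ℝ (S × A)}

/-- The pessimism term of an admissible data distribution telescopes. -/
theorem Admissible.dataMean_pessimismGap (hμ : M.Admissible μ) (f : S → A → ℝ) :
    M.H * dataMean μ (M.pessimismGap f) = M.softValue f M.s₁ - M.softValue M.qStar M.s₁ -
      M.H * dataMean μ (fun s a => f s a - M.bellman f s a) := by
  have h := hμ.sum_mul_sub fun s => M.softValue f s - M.softValue M.qStar s
  have hpt : ∀ s a, (M.softValue f s - M.softValue M.qStar s) -
      ∑ u, M.P s a u * (M.softValue f u - M.softValue M.qStar u) =
      M.pessimismGap f s a + (f s a - M.bellman f s a) := fun s a => by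
    have hq := congrFun (congrFun M.bellman_qStar s) a
    simp only [pessimismGap, bellman, mul_sub, Finset.sum_sub_distrib] at hq ⊢
    linarith
  simp only [hpt, mul_add, Finset.sum_add_distrib] at h
  simp only [dataMean]
  linarith

theorem occ_mul_le_coverage {π : Policy S A} (hC : M.coverage μ π ≠ ⊤) (s : S) (a : A) :
    M.occ π s * (π s).1 a ≤ (M.coverage μ π).toReal * (M.H * μ.1 (s, a)) := by
  have h : ENNReal.ofReal (M.occ π s * (π s).1 a) / ENNReal.ofReal (M.H * μ.1 (s, a)) ≤
      M.coverage μ π :=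
    le_iSup₂ (f := fun s a => ENNReal.ofReal (M.occ π s * (π s).1 a) /
      ENNReal.ofReal (M.H * μ.1 (s, a))) s a
  rw [ENNReal.div_le_iff_le_mul (Or.inr hC) (Or.inl ENNReal.ofReal_ne_top),
    ← ENNReal.ofReal_toReal hC, ← ENNReal.ofReal_mul ENNReal.toReal_nonneg] at h
  exact (ENNReal.ofReal_le_ofReal_iff (mul_nonneg ENNReal.toReal_nonneg
    (mul_nonneg (Nat.cast_nonneg _) (μ.2.1 _)))).1 h

/-- Both d and Hμ have total mass H. This absorbs bare terms H / λ into H C / λ. -/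
theorem one_le_coverage {π : Policy S A} (hC : M.coverage μ π ≠ ⊤) :
    1 ≤ (M.coverage μ π).toReal := by
  have h := Finset.sum_le_sum fun s (_ : s ∈ Finset.univ) =>
    Finset.sum_le_sum fun a (_ : a ∈ Finset.univ) => occ_mul_le_coverage hC s a
  simp only [← Finset.mul_sum] at h
  rw [sum_sum_eq_one, mul_one] at h
  simp only [(π _).2.2, mul_one, M.sum_occ] at h
  have := M.one_le_H_real
  exact le_of_mul_le_mul_right (by linarith) (show (0 : ℝ) < M.H by linarith)

/-- Transfer between the occupancy of a covered policy and the data distribution. -/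
theorem dataMean_sub_sum_occ_le {π : Policy S A} (hC : M.coverage μ π ≠ ⊤) {lam : ℝ}
    (hlam : 0 < lam) (e : S → A → ℝ) :
    M.H * dataMean μ e - ∑ s, M.occ π s * ∑ a, (π s).1 a * e s a ≤
      lam / 4 * (M.H * dataMean μ fun s a => e s a ^ 2) +
        4 * (M.H * (M.coverage μ π).toReal / lam) := by
  have hC1 := one_le_coverage hC
  have hH := M.one_le_H_real
  set C := (M.coverage μ π).toReal
  -- Used with c = 1 under Hμ and c = C under d ≤ C Hμ: each spends λ/8 of the square, together the
  -- λ/4 that CQL supplies.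
  have hamgm : ∀ c x : ℝ, 0 < c → |x| ≤ lam / (8 * c) * x ^ 2 + 2 * c / lam := by
    intro c x hc
    have h1 : lam / (8 * c) * x ^ 2 + 2 * c / lam - |x| =
        (lam * |x| - 4 * c) ^ 2 / (8 * c * lam) := by
      rw [← sq_abs x]
      field_simp
      ring
    have h2 : 0 ≤ (lam * |x| - 4 * c) ^ 2 / (8 * c * lam) := by positivity
    linarith
  have hpt : ∀ s a, M.H * (μ.1 (s, a) * e s a) - M.occ π s * ((π s).1 a * e s a) ≤
      lam / 4 * (M.H * (μ.1 (s, a) * e s a ^ 2)) + (2 / lam * (M.H * μ.1 (s, a)) +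
        2 * C / lam * (M.occ π s * (π s).1 a)) := by
    intro s a
    have hd : M.occ π s * (π s).1 a ≤ C * (M.H * μ.1 (s, a)) := occ_mul_le_coverage hC s a
    have hd0 : 0 ≤ M.occ π s * (π s).1 a := mul_nonneg (M.occ_nonneg π s) ((π s).2.1 a)
    have hm0 : 0 ≤ M.H * μ.1 (s, a) := mul_nonneg (by linarith) (μ.2.1 _)
    have h1 := mul_le_mul_of_nonneg_left ((le_abs_self _).trans (hamgm 1 (e s a) one_pos)) hm0
    have h2 := mul_le_mul_of_nonneg_left ((neg_abs_le _).trans' (neg_le_neg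
      (hamgm C (e s a) (by linarith)))) hd0
    have h3 : M.occ π s * (π s).1 a * (lam / (8 * C) * e s a ^ 2) ≤
        M.H * μ.1 (s, a) * (lam / 8 * e s a ^ 2) := by
      have := mul_le_mul_of_nonneg_right hd (show 0 ≤ lam / (8 * C) * e s a ^ 2 by positivity)
      refine this.trans_eq ?_
      field_simp
    rw [mul_one] at h1
    have e1 : 2 / lam * (M.H * μ.1 (s, a)) = M.H * μ.1 (s, a) * (2 * 1 / lam) := by ring
    have e2 : 2 * C / lam * (M.occ π s * (π s).1 a) = M.occ π s * (π s).1 a * (2 * C / lam) := by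
      ring
    rw [e1, e2]
    linarith
  have hs := Finset.sum_le_sum fun s (_ : s ∈ Finset.univ) =>
    Finset.sum_le_sum fun a (_ : a ∈ Finset.univ) => hpt s a
  simp only [Finset.sum_sub_distrib, Finset.sum_add_distrib, ← Finset.mul_sum] at hs
  rw [sum_sum_eq_one] at hs
  simp only [(π _).2.2, mul_one, M.sum_occ] at hs
  simp only [dataMean]
  refine hs.trans ?_
  have h4 : 2 / lam * (M.H : ℝ) ≤ 2 * C / lam * M.H := by gcongr; linarith
  have h5 : 4 * (M.H * C / lam) = 2 * C / lam * M.H + 2 * C / lam * M.H := by ring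
  linarith

/-- Occupancy-weighted divergence of the CQL policy from an optimal policy. -/
theorem Concentrated.sum_occ_klFin_le {n : ℕ} {F G : Finset (S → A → ℝ)} {lam L : ℝ}
    {D : Fin n → Observation S A} (h : M.Concentrated F G μ lam L D) (hn : 1 ≤ n)
    (hlam : 0 < lam) (hL : 0 ≤ L) (hQ : M.qStar ∈ F) (hFG : ∀ f ∈ F, M.bellman f ∈ G)
    (hμ : M.Admissible μ) {π : Policy S A} (hπ : M.IsOptimal π) (hC : M.coverage μ π ≠ ⊤)
    {f : S → A → ℝ} (hf : M.IsCQL F G lam D f) :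
    M.α * ∑ s, M.occ π s * klFin (π s) (M.softmax f s) ≤
      19 * (lam * M.H ^ 3 * L / n) + 6 * (M.H * (M.coverage μ π).toReal / lam) := by
  have hH := M.one_le_H_real
  have h1 := mul_le_mul_of_nonneg_left (h.dataMean_le hn hlam hL hQ hFG hf)
    (show (0 : ℝ) ≤ M.H by linarith)
  have h2 := hμ.dataMean_pessimismGap f
  have h3 := M.softValue_sub_J f π
  have h4 := dataMean_sub_sum_occ_le hC hlam fun s a => f s a - M.bellman f s a
  simp only [mul_add, Finset.sum_add_distrib] at h3
  simp only [mul_left_comm _ M.α, ← Finset.mul_sum] at h3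
  rw [hπ.J_eq] at h3
  have h5 : M.H / lam ≤ M.H * (M.coverage μ π).toReal / lam := by
    gcongr
    exact le_mul_of_one_le_right (by linarith) (one_le_coverage hC)
  have e1 : M.H * (19 * lam * M.H ^ 2 * L / n + 2 / lam) =
      19 * (lam * M.H ^ 3 * L / n) + 2 * (M.H / lam) := by ring
  rw [e1] at h1
  linarith

/-- Regret of CQL on a data set with small deviations. -/
theorem Concentrated.regret_le {K : ℝ} (hK : 1 ≤ K) (hα : M.α ≤ K * M.H) {n : ℕ}
    {F G : Finset (S → A → ℝ)} {lam L ℓ : ℝ} {D : Fin n → Observation S A}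
    (h : M.Concentrated F G μ lam L D) (hn : 1 ≤ n) (hlam : 0 < lam) (hL : 0 ≤ L)
    (hℓ : L ≤ 3 * ℓ) (hF : ∀ f ∈ F, ∀ s a, f s a ∈ Set.Icc (0 : ℝ) M.H)
    (hQ : M.qStar ∈ F) (hFG : ∀ f ∈ F, M.bellman f ∈ G) (hμ : M.Admissible μ) {π : Policy S A}
    (hπ : M.IsOptimal π) (hC : M.coverage μ π ≠ ⊤) {f : S → A → ℝ} (hf : M.IsCQL F G lam D f) :
    M.J π - M.J (M.softmax f) ≤ 57 * (8 + 2 * K) * K * ((M.H : ℝ) ^ 4 / M.α ^ 2 *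
      (lam * (M.H : ℝ) ^ 2 * ℓ / n + M.H * (M.coverage μ π).toReal / lam)) := by
  have hH := M.one_le_H_real
  have hα0 := M.α_pos
  have hn0 : (0 : ℝ) < n := by exact_mod_cast hn
  have hfF : f ∈ F := hf.choose_spec.2.1
  have h1 := M.sub_J_softmax_le hπ (hF f hfF) (hF _ hQ)
  have h2 := h.sum_occ_klFin_le hn hlam hL hQ hFG hμ hπ hC hf
  set C := (M.coverage μ π).toReal
  have hC0 : 0 ≤ C := ENNReal.toReal_nonneg
  have hℓ0 : 0 ≤ ℓ := by linarith
  set W := ∑ s, M.occ π s * klFin (π s) (M.softmax f s)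
  have hW : 0 ≤ W := Finset.sum_nonneg fun s _ =>
    mul_nonneg (M.occ_nonneg π s) (klFin_nonneg _ _ (M.softmax_pos f s))
  set X := lam * (M.H : ℝ) ^ 2 * ℓ / n with hX
  set Y := M.H * C / lam with hY
  have hX0 : 0 ≤ X := by positivity
  have hY0 : 0 ≤ Y := by positivity
  have hXY : 19 * (lam * M.H ^ 3 * L / n) + 6 * Y ≤ 57 * M.H * (X + Y) := by
    have : lam * M.H ^ 3 * L / n ≤ lam * M.H ^ 3 * (3 * ℓ) / n := by gcongr
    have e : lam * M.H ^ 3 * (3 * ℓ) / n = 3 * (M.H * X) := by rw [hX]; ring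
    nlinarith
  have hcoef : 4 * (M.H : ℝ) ^ 2 + 4 * M.H + 2 * M.α ≤ (8 + 2 * K) * M.H ^ 2 := by
    nlinarith [mul_le_mul_of_nonneg_left hH (show (0 : ℝ) ≤ K * M.H by positivity)]
  have h3 : M.J π - M.J (M.softmax f) ≤ (8 + 2 * K) * M.H ^ 2 * W :=
    h1.trans (mul_le_mul_of_nonneg_right hcoef hW)
  refine h3.trans ?_
  have h4 : M.α * W ≤ 57 * M.H * (X + Y) := h2.trans hXY
  -- The bound on α W is multiplied by α ≤ K H to reach the stated form H⁴ / α².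
  have h5 : M.α ^ 2 * W ≤ K * M.H * (57 * M.H * (X + Y)) := by
    rw [sq, mul_assoc]
    exact mul_le_mul hα h4 (by positivity) (by positivity)
  have h6 : W ≤ K * M.H * (57 * M.H * (X + Y)) / M.α ^ 2 := by
    rw [le_div_iff₀ (by positivity)]; linarith
  refine (mul_le_mul_of_nonneg_left h6 (by positivity)).trans_eq ?_
  ring

end KLRegularizedMDP

/-- For N ≥ 2 the union-bound factor 3 is absorbed by 3N ≤ N³. At N = 1 the second bound fails as δ
tends to 1. -/
theorem log_three_mul_div_le {N δ : ℝ} (hN : 2 ≤ N) (hδ : δ ∈ Set.Ioo (0 : ℝ) 1) :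
    0 ≤ Real.log (3 * N / δ) ∧ Real.log (3 * N / δ) ≤ 3 * Real.log (N / δ) := by
  have h0 := hδ.1
  refine ⟨Real.log_nonneg ?_, ?_⟩
  · rw [le_div_iff₀ h0]; linarith [hδ.2]
  · rw [show (3 : ℝ) * Real.log (N / δ) = Real.log ((N / δ) ^ 3) by simp]
    refine Real.log_le_log (by positivity) ?_
    rw [div_pow, div_le_div_iff₀ h0 (by positivity)]
    have h1 : δ ^ 3 ≤ δ := pow_le_of_le_one h0.le hδ.2.le (by norm_num)
    have h2 : 3 * N ≤ N ^ 3 := by nlinarith [mul_nonneg (sub_nonneg.2 hN) (sub_nonneg.2 hN)]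
    exact mul_le_mul h2 h1 (by positivity) (by positivity)

end

theorem mainTheorem3 (K : ℝ) :
    ∃ C : ℝ, 0 < C ∧
      ∀ (S A Ω : Type*) [Fintype S] [Fintype A]
        [MeasurableSpace S] [MeasurableSingletonClass S]
        [MeasurableSpace A] [MeasurableSingletonClass A]
        [MeasurableSpace Ω] (Pr : Measure Ω) [IsProbabilityMeasure Pr]
        (M : KLRegularizedMDP S A) (_ : M.α ≤ K * M.H)
        -- function classes: boundedness, realizability, Bellman completeness
        (F G : Finset (S → A → ℝ))
        (_ : ∀ f ∈ F, ∀ s a, f s a ∈ Set.Icc (0 : ℝ) M.H)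
        (_ : M.qStar ∈ F) (_ : ∀ f ∈ F, M.bellman f ∈ G)
        -- admissible data distribution that covers the optimal policy
        (μ : stdSimplex ℝ (S × A)) (_ : M.Admissible μ)
        (πstar : Policy S A) (_ : M.IsOptimal πstar) (_ : M.coverage μ πstar ≠ ⊤)
        -- n i.i.d. observations
        (n : ℕ) (_ : 1 ≤ n) (ν : Measure (Observation S A)) (_ : M.IsSamplingLaw μ ν)
        (D : Fin n → Ω → Observation S A) (_ : ∀ i, Measurable (D i))
        (_ : iIndepFun D Pr) (_ : ∀ i, Pr.map (D i) = ν)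
        (lam : ℝ) (_ : 0 < lam) (δ : ℝ) (_ : δ ∈ Set.Ioo (0 : ℝ) 1),
        ENNReal.ofReal (1 - δ) ≤
          Pr {ω | ∀ fhat, M.IsCQL F G lam (fun i => D i ω) fhat →
            ∀ πhat, M.IsGreedy fhat πhat →
              M.J πstar - M.J πhat ≤
                C * ((M.H : ℝ) ^ 4 / M.α ^ 2 *
                  (lam * (M.H : ℝ) ^ 2 * Real.log ((F.card : ℝ) * G.card / δ) / n +
                    M.H * (M.coverage μ πstar).toReal / lam))} := by
  -- The factor 57 is 19 · 3, from `Concentrated.sum_occ_klFin_le` and the logarithm; 8 + 2K bounds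
  -- the coefficient of the regret; the last K pays for α ≤ K H. The maximum keeps the constant
  -- positive for every real K.
  refine ⟨57 * (8 + 2 * max K 1) * max K 1, by positivity, ?_⟩
  intro S A Ω _ _ _ _ _ _ _ Pr _ M hα F G hF hQ hFG μ hμ πstar hπ hC n hn ν hν D hD hind hlaw
    lam hlam δ hδ
  have hα' : M.α ≤ max K 1 * M.H :=
    hα.trans (mul_le_mul_of_nonneg_right (le_max_left _ _) (Nat.cast_nonneg _))
  have hFc : 1 ≤ F.card := Finset.card_pos.2 ⟨_, hQ⟩
  have hGc : (1 : ℝ) ≤ G.card := by exact_mod_cast Finset.card_pos.2 ⟨_, hFG _ hQ⟩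
  -- If F is a singleton, log (|F||G| / δ) may be too small for the union bound, but then the output
  -- is Q⋆ and the regret is zero. Otherwise |F||G| ≥ 2.
  rcases hFc.eq_or_lt with hF1 | hF2
  · obtain ⟨f₀, hf₀⟩ := Finset.card_eq_one.1 hF1.symm
    have huniv : ∀ ω, ∀ fhat, M.IsCQL F G lam (fun i => D i ω) fhat →
        ∀ πhat, M.IsGreedy fhat πhat → M.J πstar - M.J πhat ≤
          57 * (8 + 2 * max K 1) * max K 1 * ((M.H : ℝ) ^ 4 / M.α ^ 2 *
            (lam * (M.H : ℝ) ^ 2 * Real.log ((F.card : ℝ) * G.card / δ) / n +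
              M.H * (M.coverage μ πstar).toReal / lam)) := by
      intro ω fhat hf πhat hg
      have hfQ : fhat = M.qStar := by
        have h1 : fhat ∈ F := hf.choose_spec.2.1
        rw [hf₀, Finset.mem_singleton] at h1 hQ
        rw [h1, hQ]
      have hJ : M.J πhat = M.softValue M.qStar M.s₁ := by
        rw [hg.eq_softmax, hfQ]
        exact M.value_softmax M.bellman_qStar M.s₁
      have hlog : 0 ≤ Real.log ((F.card : ℝ) * G.card / δ) := by
        refine Real.log_nonneg ?_
        rw [← hF1, le_div_iff₀ hδ.1]
        push_cast
        linarith [hδ.2]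
      rw [hJ, hπ.J_eq, sub_self]
      have := ENNReal.toReal_nonneg (a := M.coverage μ πstar)
      positivity
    refine le_trans ?_ (measure_mono (s := Set.univ) fun ω _ => huniv ω)
    rw [measure_univ, ← ENNReal.ofReal_one]
    exact ENNReal.ofReal_le_ofReal (by linarith [hδ.1])
  · have hN : (2 : ℝ) ≤ F.card * G.card := by
      have : (2 : ℝ) ≤ F.card := by exact_mod_cast hF2
      nlinarith
    have hlog := log_three_mul_div_le hN hδ
    refine (M.measure_concentrated_ge hF hQ ⟨_, hFG _ hQ⟩ hν hD hind hlaw lam hδ.1).trans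
      (measure_mono fun ω hω fhat hf πhat hg => ?_)
    rw [hg.eq_softmax]
    exact hω.regret_le (le_max_right _ _) hα' hn hlam hlog.1 hlog.2 hF hQ hFG hμ hπ hC hf
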